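/- Let $(V,\otimes,k)$ be a commutative quantale (a complete lattice with a commutative monoid structure whose multiplication preserves suprema in each variable) with $k\neq\bot$, and let $[-,-]$ be its internal hom. \emph{Definitions.} A $V$-category $(X,a)$ is a set with $a:X\times X\to V$ such that $k\le a(x,x)$ and $a(x,y)\otimes a(y,z)\le a(x,z)$; it is separated if $k\le a(x,y)$ and $k\le a(y,x)$ imply $x=y$; it is cocomplete if it has all weighted colimits. A $V$-functor is a map $f$ with $a(x,y)\le b(f(x),f(y))$. A monoidal $V$-category $(X,a,*,u)$ is a $V$-category with a monoid structure such that $a(x,x')\otimes a(y,y')\le a(x*y,x'*y')$; a $V$-functor $f$ between monoidal $V$-categories is lax monoidal if $k\le b(u,f(u))$ and $k\le b(f(x)*f(y),f(x*y))$; a monoidal $V$-category is residuated if all $x*(-)$ and $(-)*x$ have right adjoint $V$-functors. A $V$-quantale is a separated cocomplete monoidal $V$-category for which all $x*(-)$ and $(-)*x$ preserve weighted colimits. With $LX$ the set of finite lists in $X$, an $(L,V)$-category is a set $X$ with a map $a:LX\times X\to V$ such that $k\le a((x),x)$ and $$a(\underline x_1,y_1)\otimes\cdots\otimes a(\underline x_n,y_n)\otimes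 a((y_1,\dots,y_n),z)\le a((\underline x_1;\dots;\underline x_n),z);$$ it is separated if the $V$-category $(x,y)\mapsto a((x),y)$ is. An $(L,V)$-functor $f:(X,a)\to(Y,b)$ is a map with $a((x_1,\dots,x_n),y)\le b((f(x_1),\dots,f(x_n)),f(y))$; it is fully faithful if equality always holds. A monoidal $V$-category is regarded as an $(L,V)$-category through $a((x_1,\dots,x_n),y)=a(x_1*\cdots*x_n,y)$, where the empty product is $u$; an $(L,V)$-category "is a $V$-quantale" if its structure arises in this way from a $V$-quantale. A promonoidal $V$-category $(X,a,P,J)$ is a monoid in the monoidal category of $V$-distributors; a promonoidal functor is a $V$-functor $f$ with $P(x,y,z)\le P(f(x),f(y),f(z))$ and $J(x)\le J(f(x))$. It is regarded as an $(L,V)$-category through $a_0=J$, $a_1=a$, $a_2=P$, $a_n=P\cdot(\mathrm{Id}\boxtimes a_{n-1})$. A $V$-quantum B-algebra is a promonoidal $V$-category with operations $\rhd,\lhd$ and an element $u$ such that $P(x,z,y)=a(z,x\lhd y)$, $P(z,x,y)=a(z,x\rhd y)$ and $J(x)=a(u,x)$; its morphisms are the $V$-functors with $f(x\rhd y)\le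 f(x)\rhd f(y)$, $f(x\lhd y)\le f(x)\lhd f(y)$ and $u\le f(u)$, where $x\le y$ means $k\le a(x,y)$. In each category below, an object $X$ is called injective if for all morphisms $i:Y\to Z$ and $g:Y\to X$ of the category, with $i$ fully faithful as an $(L,V)$-functor, there is a morphism $h:Z\to X$ with $h\circ i=g$. \textbf{Theorem.} Let $C$ be a full subcategory of the category of $(L,V)$-categories and $(L,V)$-functors which contains all $V$-quantales, and let $X$ be a separated object of $C$. Then $X$ is injective in $C$ if and only if $X$ is a $V$-quantale. In particular, a separated object is injective if and only if it is a $V$-quantale in each of the following categories: promonoidal $V$-categories and promonoidal $V$-functors; monoidal $V$-categories and lax monoidal $V$-functors; residuated monoidal $V$-categories and lax monoidal $V$-functors; $V$-quantum B-algebras and their morphisms. For the two-element quantale this recovers the following. (a) (Lambek et al.) In the category of partially ordered monoids and monotone maps with $f(x)f(y)\le f(xy)$ and $1\le f(1)$, a partially ordered monoid is injective with respect to embeddings (morphisms $f$ for which $f(x_1)\cdots f(x_n)\le f(x)$ implies $x_1\cdots x_n\le x$, for all $n\ge 0$) if and only if it is a (unital) quantale. (b) (Rump) Let a unital quantum B-algebra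 be a partially ordered set with binary operations $\rhd,\lhd$, monotone in the second variable, and an element $u$, such that $x\le y\rhd z\iff y\le x\lhd z$, $x\rhd(y\lhd z)=y\lhd(x\rhd z)$ and $u\rhd x=x=u\lhd x$. Morphisms are the monotone maps with $f(x\rhd y)\le f(x)\rhd f(y)$, $f(x\lhd y)\le f(x)\lhd f(y)$ and $u\le f(u)$; an embedding is a morphism that reflects the relations $x_1\le x_2\rhd(\cdots(x_n\rhd y))$ for $n\ge1$ and $u\le y$ for $n=0$. A unital quantum B-algebra is injective with respect to embeddings if and only if it is a unital quantale, that is, it carries a quantale multiplication with unit $u$, for its order, whose residuals are $\rhd$ and $\lhd$: $x*y\le z\iff x\le y\rhd z\iff y\le x\lhd z$. -/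

import Mathlib

open CategoryTheory
open scoped Quantale

universe v w w'

section EnrichedCategories

/- Throughout, `V` is a commutative quantale: a complete lattice with a commutative monoid
structure `(*, 1)` whose multiplication preserves suprema in each variable.  The internal hom
`[x, y]` of `V` is Mathlib's residuation `x ⇨ₗ y = sSup {z | z * x ≤ y}`. -/
variable (V : Type v) [CommMonoid V] [CompleteLattice V] [IsQuantale V]

/-- A `V`-category. -/
structure VCat where
  carrier : Type w
  hom : carrier → carrier → V
  one_le_hom : ∀ x, 1 ≤ hom x x
  hom_mul_hom_le : ∀ x y z, hom x y * hom y z ≤ hom x z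

variable {V}

/-- A `V`-functor. -/
@[ext]
structure VFunctor (X : VCat.{v, w} V) (Y : VCat.{v, w'} V) where
  map : X.carrier → Y.carrier
  hom_le : ∀ x y, X.hom x y ≤ Y.hom (map x) (map y)

/-- The identity `V`-functor. -/
def VFunctor.id (X : VCat.{v, w} V) : VFunctor X X where
  map := fun x => x
  hom_le := fun _ _ => le_rfl

/-- The composite of `f : X → Y` and `g : Y → Z` (first `f`, then `g`). -/
def VFunctor.comp {X Y Z : VCat.{v, w} V} (f : VFunctor X Y) (g : VFunctor Y Z) :
    VFunctor X Z where
  map := fun x => g.map (f.map x)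
  hom_le := fun x y => (f.hom_le x y).trans (g.hom_le _ _)

/-- A `V`-category is separated if isomorphic elements are equal. -/
def VCat.Separated (X : VCat.{v, w} V) : Prop :=
  ∀ x y : X.carrier, 1 ≤ X.hom x y → 1 ≤ X.hom y x → x = y

variable (V) in
/-- The one-point `V`-category `K = (1, k)`. -/
def VCat.unit : VCat.{v, w} V where
  carrier := PUnit.{w + 1}
  hom := fun _ _ => 1
  one_le_hom := fun _ => le_rfl
  hom_mul_hom_le := fun _ _ _ => by simp

/-- The tensor product of two `V`-categories. -/
def VCat.tensor (X Y : VCat.{v, w} V) : VCat.{v, w} V where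
  carrier := X.carrier × Y.carrier
  hom := fun p q => X.hom p.1 q.1 * Y.hom p.2 q.2
  one_le_hom := fun p => by
    have h := mul_le_mul' (X.one_le_hom p.1) (Y.one_le_hom p.2)
    rwa [one_mul] at h
  hom_mul_hom_le := fun p q r => by
    rw [mul_mul_mul_comm]
    exact mul_le_mul' (X.hom_mul_hom_le _ _ _) (Y.hom_mul_hom_le _ _ _)

/-- A `V`-distributor from `X` to `Y`: a `V`-relation `j` with `j · a ≤ j` and `b · j ≤ j`. -/
structure VDist (X Y : VCat.{v, w} V) where
  rel : X.carrier → Y.carrier → V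
  hom_mul_rel_le : ∀ x x' y, X.hom x x' * rel x' y ≤ rel x y
  rel_mul_hom_le : ∀ x y y', rel x y * Y.hom y y' ≤ rel x y'

/-- `g : Z → Y` is the colimit of `f : X → Y` weighted by the distributor `j` from `X` to `Z`. -/
def IsWeightedColimit {X Y Z : VCat.{v, w} V} (j : VDist X Z) (f : VFunctor X Y)
    (g : VFunctor Z Y) : Prop :=
  ∀ (z : Z.carrier) (y : Y.carrier),
    Y.hom (g.map z) y = ⨅ x : X.carrier, (j.rel x z ⇨ₗ Y.hom (f.map x) y)

/-- A `V`-category is cocomplete if it has all weighted colimits. -/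
def VCat.Cocomplete (Y : VCat.{v, w} V) : Prop :=
  ∀ (X Z : VCat.{v, w} V) (f : VFunctor X Y) (j : VDist X Z),
    ∃ g : VFunctor Z Y, IsWeightedColimit j f g

/-- A `V`-functor is cocontinuous if it preserves all weighted colimits that exist. -/
def VFunctor.Cocontinuous {Y W : VCat.{v, w} V} (F : VFunctor Y W) : Prop :=
  ∀ (X Z : VCat.{v, w} V) (f : VFunctor X Y) (j : VDist X Z) (g : VFunctor Z Y),
    IsWeightedColimit j f g → IsWeightedColimit j (f.comp F) (g.comp F)

/-- A `V`-functor `f : X → Y` has a right adjoint. -/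
def VFunctor.HasRightAdjoint {X Y : VCat.{v, w} V} (f : VFunctor X Y) : Prop :=
  ∃ g : VFunctor Y X, ∀ x y, Y.hom (f.map x) y = X.hom x (g.map y)

/-! ### `(L,V)`-categories -/

/-- The extension of the list monad to `V`-relations: `r x₁ y₁ * ⋯ * r xₙ yₙ` for two lists of
the same length, and `⊥` otherwise. -/
def listExt {X : Type w} {Y : Type w'} (r : X → Y → V) : List X → List Y → V
  | [], [] => 1
  | x :: xs, y :: ys => r x y * listExt r xs ys
  | [], _ :: _ => ⊥
  | _ :: _, [] => ⊥

variable (V) in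
/-- An `(L,V)`-category: a set `X` with a relation `a : List X → X → V` such that `e_X° ≤ a` and
`a ∘ a ≤ a`, where `a ∘ a = a · L a · m_X°` and `m_X` is concatenation. -/
structure LVCat where
  carrier : Type w
  hom : List carrier → carrier → V
  one_le_hom : ∀ x, 1 ≤ hom [x] x
  listExt_mul_hom_le : ∀ (xss : List (List carrier)) (ys : List carrier) (z : carrier),
    listExt hom xss ys * hom ys z ≤ hom xss.flatten z

/-- An `(L,V)`-functor. -/
@[ext]
structure LVFunctor (X Y : LVCat.{v, w} V) where
  map : X.carrier → Y.carrier
  hom_le : ∀ xs y, X.hom xs y ≤ Y.hom (xs.map map) (map y)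

/-- The category of `(L,V)`-categories and `(L,V)`-functors. -/
instance LVCat.category : Category (LVCat.{v, w} V) where
  Hom X Y := LVFunctor X Y
  id X := ⟨fun x => x, fun xs y => by simp⟩
  comp f g := ⟨fun x => g.map (f.map x), fun xs y => by
    have h := (f.hom_le xs y).trans (g.hom_le _ _)
    rw [List.map_map] at h
    exact h⟩

/-- An `(L,V)`-functor is fully faithful if the defining inequality is an equality. -/
def LVCat.FullyFaithful {X Y : LVCat.{v, w} V} (f : X ⟶ Y) : Prop :=
  ∀ (xs : List X.carrier) (y : X.carrier),
    X.hom xs y = Y.hom (xs.map (LVFunctor.map f)) (LVFunctor.map f y)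

/-- The underlying `V`-category of an `(L,V)`-category. -/
def LVCat.underlying (X : LVCat.{v, w} V) : VCat.{v, w} V where
  carrier := X.carrier
  hom := fun x y => X.hom [x] y
  one_le_hom := X.one_le_hom
  hom_mul_hom_le := fun x y z => by
    have h := X.listExt_mul_hom_le [[x]] [y] z
    simpa [listExt] using h

/-- An `(L,V)`-category is separated if its underlying `V`-category is. -/
def LVCat.Separated (X : LVCat.{v, w} V) : Prop := X.underlying.Separated

/-- Let `D` be a category with a functor `F` to `(L,V)`-categories.  An object `X` of `D` is
injective, with respect to the fully faithful `(L,V)`-functors, if every morphism `Y ⟶ X` of `D`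
extends along every morphism `Y ⟶ Z` of `D` that is fully faithful as an `(L,V)`-functor. -/
def InjectiveAlong {D : Type*} [Category D] (F : D ⥤ LVCat.{v, w} V) (X : D) : Prop :=
  ∀ ⦃Y Z : D⦄ (i : Y ⟶ Z) (g : Y ⟶ X), LVCat.FullyFaithful (F.map i) →
    ∃ h : Z ⟶ X, i ≫ h = g

/-! ### Monoidal `V`-categories and `V`-quantales -/

variable (V) in
/-- A monoidal `V`-category: a monoid in `V`-categories with respect to the tensor product. -/
structure MonVCat extends VCat.{v, w} V where
  mul : VFunctor (toVCat.tensor toVCat) toVCat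
  one : VFunctor (VCat.unit.{v, w} V) toVCat
  mul_assoc : ∀ x y z : carrier, mul.map (mul.map (x, y), z) = mul.map (x, mul.map (y, z))
  one_mul : ∀ x : carrier, mul.map (one.map PUnit.unit, x) = x
  mul_one : ∀ x : carrier, mul.map (x, one.map PUnit.unit) = x

/-- The product `x₁ * ⋯ * xₙ` of a list (the unit for the empty list). -/
def MonVCat.listMul (X : MonVCat.{v, w} V) : List X.carrier → X.carrier
  | [] => X.one.map PUnit.unit
  | x :: xs => X.mul.map (x, X.listMul xs)

/-- Left multiplication by `x`, as a `V`-functor. -/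
def MonVCat.mulLeft (X : MonVCat.{v, w} V) (x : X.carrier) : VFunctor X.toVCat X.toVCat where
  map := fun y => X.mul.map (x, y)
  hom_le := fun y z => by
    have h := mul_le_mul' (X.one_le_hom x) (le_refl (X.hom y z))
    rw [_root_.one_mul] at h
    exact h.trans (X.mul.hom_le (x, y) (x, z))

/-- Right multiplication by `x`, as a `V`-functor. -/
def MonVCat.mulRight (X : MonVCat.{v, w} V) (x : X.carrier) : VFunctor X.toVCat X.toVCat where
  map := fun y => X.mul.map (y, x)
  hom_le := fun y z => by
    have h := mul_le_mul' (le_refl (X.hom y z)) (X.one_le_hom x)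
    rw [_root_.mul_one] at h
    exact h.trans (X.mul.hom_le (y, x) (z, x))

/-- A monoidal `V`-category is a `V`-quantale if it is separated and cocomplete and its
multiplication is cocontinuous in each variable. -/
def MonVCat.IsVQuantale (Q : MonVCat.{v, w} V) : Prop :=
  Q.toVCat.Separated ∧ Q.toVCat.Cocomplete ∧
    ∀ x : Q.carrier, (Q.mulLeft x).Cocontinuous ∧ (Q.mulRight x).Cocontinuous

/-- A monoidal `V`-category is residuated if all left and right multiplications have right
adjoints. -/
def MonVCat.IsResiduated (X : MonVCat.{v, w} V) : Prop :=
  ∀ x : X.carrier, (X.mulLeft x).HasRightAdjoint ∧ (X.mulRight x).HasRightAdjoint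

/-- A lax monoidal `V`-functor (`x ≤ y` in a `V`-category means `1 ≤ hom x y`). -/
@[ext]
structure LaxMonFunctor (X Y : MonVCat.{v, w} V) extends VFunctor X.toVCat Y.toVCat where
  one_le_map_one : 1 ≤ Y.hom (Y.one.map PUnit.unit) (map (X.one.map PUnit.unit))
  mul_map_le : ∀ x y, 1 ≤ Y.hom (Y.mul.map (map x, map y)) (map (X.mul.map (x, y)))

theorem VCat.one_le_trans (X : VCat.{v, w} V) {x y z : X.carrier} (h : 1 ≤ X.hom x y)
    (h' : 1 ≤ X.hom y z) : 1 ≤ X.hom x z := by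
  have h2 := mul_le_mul' h h'
  rw [_root_.one_mul] at h2
  exact h2.trans (X.hom_mul_hom_le x y z)

/-- Precomposing with an inequality. -/
theorem VCat.hom_le_of_left (X : VCat.{v, w} V) {x y : X.carrier} (h : 1 ≤ X.hom x y)
    (z : X.carrier) : X.hom y z ≤ X.hom x z := by
  have h2 := mul_le_mul' h (le_refl (X.hom y z))
  rw [_root_.one_mul] at h2
  exact h2.trans (X.hom_mul_hom_le x y z)

/-- Postcomposing with an inequality. -/
theorem VCat.hom_le_of_right (X : VCat.{v, w} V) {y z : X.carrier} (h : 1 ≤ X.hom y z)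
    (x : X.carrier) : X.hom x y ≤ X.hom x z := by
  have h2 := mul_le_mul' (le_refl (X.hom x y)) h
  rw [_root_.mul_one] at h2
  exact h2.trans (X.hom_mul_hom_le x y z)

/-- The category of monoidal `V`-categories and lax monoidal `V`-functors. -/
instance MonVCat.category : Category (MonVCat.{v, w} V) where
  Hom X Y := LaxMonFunctor X Y
  id X := ⟨VFunctor.id _, X.one_le_hom _, fun _ _ => X.one_le_hom _⟩
  comp {X Y Z} f g := ⟨f.toVFunctor.comp g.toVFunctor,
    Z.one_le_trans g.one_le_map_one (f.one_le_map_one.trans (g.hom_le _ _)),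
    fun x y => Z.one_le_trans (g.mul_map_le _ _) ((f.mul_map_le x y).trans (g.hom_le _ _))⟩

theorem MonVCat.listMul_append (X : MonVCat.{v, w} V) (xs ys : List X.carrier) :
    X.listMul (xs ++ ys) = X.mul.map (X.listMul xs, X.listMul ys) := by
  induction xs with
  | nil => simp [listMul, X.one_mul]
  | cons x xs ih => simp [listMul, ih, X.mul_assoc]

/-- The `(L,V)`-category of a monoidal `V`-category: `a(x₁ * ⋯ * xₙ, y)`. -/
def MonVCat.toLVCat (X : MonVCat.{v, w} V) : LVCat.{v, w} V where
  carrier := X.carrier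
  hom := fun xs y => X.hom (X.listMul xs) y
  one_le_hom := fun x => by
    simp only [listMul, X.mul_one]
    exact X.one_le_hom x
  listExt_mul_hom_le := fun xss ys z => by
    have key : ∀ (xss : List (List X.carrier)) (ys : List X.carrier),
        listExt (fun xs y => X.hom (X.listMul xs) y) xss ys ≤
          X.hom (X.listMul xss.flatten) (X.listMul ys) := by
      intro xss
      induction xss with
      | nil =>
        intro ys
        cases ys with
        | nil => exact X.one_le_hom _
        | cons y ys => exact bot_le
      | cons xs xss ih =>
        intro ys
        cases ys with
        | nil => exact bot_le
        | cons y ys =>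
          rw [List.flatten_cons, X.listMul_append]
          exact (mul_le_mul' le_rfl (ih ys)).trans
            (X.mul.hom_le (X.listMul xs, X.listMul xss.flatten) (y, X.listMul ys))
    exact (mul_le_mul' (key xss ys) le_rfl).trans (X.hom_mul_hom_le _ _ _)

theorem LaxMonFunctor.listMul_map_le {X Y : MonVCat.{v, w} V} (f : LaxMonFunctor X Y)
    (xs : List X.carrier) : 1 ≤ Y.hom (Y.listMul (xs.map f.map)) (f.map (X.listMul xs)) := by
  induction xs with
  | nil => exact f.one_le_map_one
  | cons x xs ih =>
    exact Y.one_le_trans (ih.trans ((Y.mulLeft (f.map x)).hom_le _ _)) (f.mul_map_le _ _)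

variable (V) in
/-- The functor from monoidal `V`-categories and lax monoidal `V`-functors to
`(L,V)`-categories. -/
def kmp : MonVCat.{v, w} V ⥤ LVCat.{v, w} V where
  obj X := X.toLVCat
  map {X Y} f := ⟨f.map, fun xs y =>
    (f.hom_le _ _).trans (Y.hom_le_of_left (LaxMonFunctor.listMul_map_le f xs) _)⟩

/-- An `(L,V)`-category is a `V`-quantale if its structure is the one induced by a
`V`-quantale. -/
def LVCat.IsVQuantale (X : LVCat.{v, w} V) : Prop :=
  ∃ Q : MonVCat.{v, w} V, Q.IsVQuantale ∧ (kmp V).obj Q = X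

variable (V) in
/-- The category of residuated monoidal `V`-categories and lax monoidal `V`-functors. -/
abbrev ResMonVCat := ObjectProperty.FullSubcategory
  (fun X : MonVCat.{v, w} V => X.IsResiduated : ObjectProperty (MonVCat.{v, w} V))

variable (V) in
/-- The functor from residuated monoidal `V`-categories to `(L,V)`-categories. -/
def resMonToLVCat : ResMonVCat.{v, w} V ⥤ LVCat.{v, w} V := ObjectProperty.ι _ ⋙ kmp V

/-! ### Promonoidal `V`-categories -/

variable (V) in
/-- A promonoidal `V`-category: a monoid in `V`-distributors. -/
structure VPro extends VCat.{v, w} V where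
  P : VDist (toVCat.tensor toVCat) toVCat
  J : VDist (VCat.unit.{v, w} V) toVCat
  assoc : ∀ a b c d : carrier,
    ⨆ x, P.rel (a, b) x * P.rel (x, c) d = ⨆ x, P.rel (a, x) d * P.rel (b, c) x
  left_unit : ∀ x y : carrier, ⨆ z, J.rel PUnit.unit z * P.rel (z, x) y = hom x y
  right_unit : ∀ x y : carrier, ⨆ z, J.rel PUnit.unit z * P.rel (x, z) y = hom x y

/-- A promonoidal `V`-functor. -/
@[ext]
structure ProFunctor (X Y : VPro.{v, w} V) extends VFunctor X.toVCat Y.toVCat where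
  P_le : ∀ x y z, X.P.rel (x, y) z ≤ Y.P.rel (map x, map y) (map z)
  J_le : ∀ x, X.J.rel PUnit.unit x ≤ Y.J.rel PUnit.unit (map x)

/-- The category of promonoidal `V`-categories and promonoidal `V`-functors. -/
instance VPro.category : Category (VPro.{v, w} V) where
  Hom X Y := ProFunctor X Y
  id X := ⟨VFunctor.id _, fun _ _ _ => le_rfl, fun _ => le_rfl⟩
  comp f g := ⟨f.toVFunctor.comp g.toVFunctor,
    fun _ _ _ => (f.P_le _ _ _).trans (g.P_le _ _ _), fun _ => (f.J_le _).trans (g.J_le _)⟩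

/-- The relation `ã = ∐ aₙ` of a promonoidal `V`-category: `a₀ = J`, `a₁ = a`, `a₂ = P` and
`aₙ = P · (Id ⊠ aₙ₋₁)`. -/
def VPro.multiHom (X : VPro.{v, w} V) : List X.carrier → X.carrier → V
  | [], y => X.J.rel PUnit.unit y
  | [x], y => X.hom x y
  | [x, x'], y => X.P.rel (x, x') y
  | x :: x' :: x'' :: xs, y => ⨆ z, X.multiHom (x' :: x'' :: xs) z * X.P.rel (x, z) y

theorem VPro.hom_mul_P_le (X : VPro.{v, w} V) (x y y' z : X.carrier) :
    X.hom y y' * X.P.rel (x, y') z ≤ X.P.rel (x, y) z := by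
  have h := X.P.hom_mul_rel_le (x, y) (x, y') z
  refine le_trans ?_ h
  refine mul_le_mul' ?_ le_rfl
  have h1 := mul_le_mul' (X.one_le_hom x) (le_refl (X.hom y y'))
  rwa [one_mul] at h1

theorem VPro.hom_mul_P_le_left (X : VPro.{v, w} V) (x x' y z : X.carrier) :
    X.hom x x' * X.P.rel (x', y) z ≤ X.P.rel (x, y) z := by
  have h := X.P.hom_mul_rel_le (x, y) (x', y) z
  refine le_trans ?_ h
  refine mul_le_mul' ?_ le_rfl
  have h1 := mul_le_mul' (le_refl (X.hom x x')) (X.one_le_hom y)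
  rwa [mul_one] at h1

theorem VPro.multiHom_cons (X : VPro.{v, w} V) (x : X.carrier) (xs : List X.carrier)
    (y : X.carrier) : X.multiHom (x :: xs) y = ⨆ z, X.multiHom xs z * X.P.rel (x, z) y := by
  match xs with
  | [] => exact (X.right_unit x y).symm
  | [x'] =>
    simp only [multiHom]
    apply le_antisymm
    · refine le_trans ?_ (le_iSup _ x')
      have h := mul_le_mul' (X.one_le_hom x') (le_refl (X.P.rel (x, x') y))
      rwa [one_mul] at h
    · exact iSup_le fun z => X.hom_mul_P_le _ _ _ _
  | x' :: x'' :: xs => rfl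

theorem VPro.multiHom_mul_hom_le (X : VPro.{v, w} V) (xs : List X.carrier) (y z : X.carrier) :
    X.multiHom xs y * X.hom y z ≤ X.multiHom xs z := by
  cases xs with
  | nil => exact X.J.rel_mul_hom_le _ _ _
  | cons x xs =>
    rw [X.multiHom_cons, X.multiHom_cons, Quantale.iSup_mul_distrib]
    refine iSup_mono fun c => ?_
    rw [mul_assoc]
    exact mul_le_mul' le_rfl (X.P.rel_mul_hom_le _ _ _)

theorem VPro.multiHom_append_le (X : VPro.{v, w} V) (xs ys : List X.carrier)
    (c d y : X.carrier) :
    X.multiHom xs c * (X.multiHom ys d * X.P.rel (c, d) y) ≤ X.multiHom (xs ++ ys) y := by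
  induction xs generalizing c d y with
  | nil =>
    have h1 : X.J.rel PUnit.unit c * X.P.rel (c, d) y ≤ X.hom d y := by
      rw [← X.left_unit d y]
      exact le_iSup (fun z => X.J.rel PUnit.unit z * X.P.rel (z, d) y) c
    rw [mul_left_comm]
    exact (mul_le_mul' le_rfl h1).trans (X.multiHom_mul_hom_le _ _ _)
  | cons x xs ih =>
    rw [X.multiHom_cons, Quantale.iSup_mul_distrib, List.cons_append, X.multiHom_cons]
    refine iSup_le fun e => ?_
    have h1 : X.P.rel (x, e) c * X.P.rel (c, d) y ≤
        ⨆ u, X.P.rel (x, u) y * X.P.rel (e, d) u := by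
      rw [← X.assoc]
      exact le_iSup (fun u => X.P.rel (x, e) u * X.P.rel (u, d) y) c
    calc X.multiHom xs e * X.P.rel (x, e) c * (X.multiHom ys d * X.P.rel (c, d) y)
        = X.multiHom xs e * X.multiHom ys d * (X.P.rel (x, e) c * X.P.rel (c, d) y) := by
          rw [mul_mul_mul_comm]
      _ ≤ X.multiHom xs e * X.multiHom ys d * ⨆ u, X.P.rel (x, u) y * X.P.rel (e, d) u :=
          mul_le_mul' le_rfl h1
      _ = ⨆ u, X.multiHom xs e * (X.multiHom ys d * X.P.rel (e, d) u) * X.P.rel (x, u) y := by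
          rw [Quantale.mul_iSup_distrib]
          refine iSup_congr fun u => ?_
          rw [mul_comm (X.P.rel (x, u) y), ← mul_assoc, mul_assoc (X.multiHom xs e)]
      _ ≤ _ := iSup_mono fun u => mul_le_mul' (ih e d u) le_rfl

/-- The `(L,V)`-category of a promonoidal `V`-category. -/
def VPro.toLVCat (X : VPro.{v, w} V) : LVCat.{v, w} V where
  carrier := X.carrier
  hom := X.multiHom
  one_le_hom := X.one_le_hom
  listExt_mul_hom_le := fun xss => by
    induction xss with
    | nil =>
      intro ys z
      cases ys with
      | nil => simp [listExt]
      | cons y ys => simp [listExt]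
    | cons xs xss ih =>
      intro ys z
      cases ys with
      | nil => simp [listExt]
      | cons y ys =>
        rw [X.multiHom_cons, Quantale.mul_iSup_distrib, List.flatten_cons]
        refine iSup_le fun c => ?_
        have h : listExt X.multiHom (xs :: xss) (y :: ys) * (X.multiHom ys c * X.P.rel (y, c) z)
            = X.multiHom xs y *
              (listExt X.multiHom xss ys * X.multiHom ys c * X.P.rel (y, c) z) := by
          simp only [listExt, mul_assoc]
        rw [h]
        exact (mul_le_mul' le_rfl (mul_le_mul' (ih ys c) le_rfl)).trans
          (X.multiHom_append_le _ _ _ _ _)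

theorem ProFunctor.multiHom_le {X Y : VPro.{v, w} V} (f : ProFunctor X Y)
    (xs : List X.carrier) (y : X.carrier) :
    X.multiHom xs y ≤ Y.multiHom (xs.map f.map) (f.map y) := by
  induction xs generalizing y with
  | nil => exact f.J_le y
  | cons x xs ih =>
    rw [X.multiHom_cons, List.map_cons, Y.multiHom_cons]
    exact iSup_le fun z => le_trans (mul_le_mul' (ih z) (f.P_le _ _ _))
      (le_iSup (fun c => Y.multiHom (xs.map f.map) c * Y.P.rel (f.map x, c) (f.map y)) (f.map z))

variable (V) in
/-- The functor from promonoidal `V`-categories to `(L,V)`-categories. -/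
def proToLVCat : VPro.{v, w} V ⥤ LVCat.{v, w} V where
  obj X := X.toLVCat
  map f := ⟨f.map, ProFunctor.multiHom_le f⟩

/-! ### `V`-quantum B-algebras -/

variable (V) in
/-- A `V`-quantum B-algebra: a representable promonoidal `V`-category. -/
structure VQBAlg extends VPro.{v, w} V where
  /-- `rimp x y` is `x ▹ y` -/
  rimp : carrier → carrier → carrier
  /-- `limp x y` is `x ◃ y` -/
  limp : carrier → carrier → carrier
  u : carrier
  P_eq_limp : ∀ x z y, P.rel (x, z) y = hom z (limp x y)
  P_eq_rimp : ∀ z x y, P.rel (z, x) y = hom z (rimp x y)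
  J_eq : ∀ x, J.rel PUnit.unit x = hom u x

/-- A morphism of `V`-quantum B-algebras. -/
@[ext]
structure QBFunctor (X Y : VQBAlg.{v, w} V) extends VFunctor X.toVCat Y.toVCat where
  rimp_le : ∀ x y, 1 ≤ Y.hom (map (X.rimp x y)) (Y.rimp (map x) (map y))
  limp_le : ∀ x y, 1 ≤ Y.hom (map (X.limp x y)) (Y.limp (map x) (map y))
  u_le : 1 ≤ Y.hom Y.u (map X.u)

/-- A morphism of `V`-quantum B-algebras is a promonoidal `V`-functor. -/
def QBFunctor.toPro {X Y : VQBAlg.{v, w} V} (f : QBFunctor X Y) :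
    ProFunctor X.toVPro Y.toVPro where
  toVFunctor := f.toVFunctor
  P_le := fun x y z => by
    rw [X.P_eq_rimp, Y.P_eq_rimp]
    exact (f.hom_le _ _).trans (Y.hom_le_of_right (f.rimp_le y z) _)
  J_le := fun x => by
    rw [X.J_eq, Y.J_eq]
    exact (f.hom_le _ _).trans (Y.hom_le_of_left f.u_le _)

theorem VQBAlg.rimp_mono (X : VQBAlg.{v, w} V) (x : X.carrier) {y z : X.carrier}
    (h : 1 ≤ X.hom y z) : 1 ≤ X.hom (X.rimp x y) (X.rimp x z) := by
  rw [← X.P_eq_rimp]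
  have h1 : 1 ≤ X.P.rel (X.rimp x y, x) y := by
    rw [X.P_eq_rimp]
    exact X.one_le_hom _
  have h2 := mul_le_mul' h1 h
  rw [one_mul] at h2
  exact h2.trans (X.P.rel_mul_hom_le _ _ _)

theorem VQBAlg.limp_mono (X : VQBAlg.{v, w} V) (x : X.carrier) {y z : X.carrier}
    (h : 1 ≤ X.hom y z) : 1 ≤ X.hom (X.limp x y) (X.limp x z) := by
  rw [← X.P_eq_limp]
  have h1 : 1 ≤ X.P.rel (x, X.limp x y) y := by
    rw [X.P_eq_limp]
    exact X.one_le_hom _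
  have h2 := mul_le_mul' h1 h
  rw [one_mul] at h2
  exact h2.trans (X.P.rel_mul_hom_le _ _ _)

/-- The category of `V`-quantum B-algebras. -/
instance VQBAlg.category : Category (VQBAlg.{v, w} V) where
  Hom X Y := QBFunctor X Y
  id X := ⟨VFunctor.id _, fun _ _ => X.one_le_hom _, fun _ _ => X.one_le_hom _, X.one_le_hom _⟩
  comp {X Y Z} f g := ⟨f.toVFunctor.comp g.toVFunctor,
    fun x y => Z.one_le_trans ((f.rimp_le x y).trans (g.hom_le _ _)) (g.rimp_le _ _),
    fun x y => Z.one_le_trans ((f.limp_le x y).trans (g.hom_le _ _)) (g.limp_le _ _),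
    Z.one_le_trans g.u_le (f.u_le.trans (g.hom_le _ _))⟩

variable (V) in
/-- The functor from `V`-quantum B-algebras to promonoidal `V`-categories. -/
def qbToPro : VQBAlg.{v, w} V ⥤ VPro.{v, w} V where
  obj X := X.toVPro
  map f := QBFunctor.toPro f

variable (V) in
/-- The functor from `V`-quantum B-algebras to `(L,V)`-categories. -/
def qbToLVCat : VQBAlg.{v, w} V ⥤ LVCat.{v, w} V := qbToPro V ⋙ proToLVCat V

end EnrichedCategories

/-! ### The ordered case -/

/-- A submultiplicative monotone map between ordered monoids. -/
def IsSubmultiplicative {M N : Type*} [Monoid M] [PartialOrder M] [Monoid N] [PartialOrder N]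
    (f : M → N) : Prop :=
  Monotone f ∧ (∀ x y, f x * f y ≤ f (x * y)) ∧ 1 ≤ f 1

/-- An embedding of ordered monoids: a submultiplicative monotone map such that
`f x₁ * ⋯ * f xₙ ≤ f x` implies `x₁ * ⋯ * xₙ ≤ x` for all `n ≥ 0`. -/
def IsOrdMonoidEmbedding {M N : Type*} [Monoid M] [PartialOrder M] [Monoid N] [PartialOrder N]
    (f : M → N) : Prop :=
  IsSubmultiplicative f ∧ ∀ (xs : List M) (x : M), (xs.map f).prod ≤ f x → xs.prod ≤ x

/-- An ordered monoid is injective (with respect to embeddings, in the category of partially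
ordered monoids and submultiplicative monotone maps). -/
def OrdMonoidInjective (M : Type w) [Monoid M] [PartialOrder M] : Prop :=
  ∀ (A B : Type w) [Monoid A] [PartialOrder A] [MulLeftMono A] [MulRightMono A]
    [Monoid B] [PartialOrder B] [MulLeftMono B] [MulRightMono B] (i : A → B) (g : A → M),
    IsOrdMonoidEmbedding i → IsSubmultiplicative g →
      ∃ h : B → M, IsSubmultiplicative h ∧ h ∘ i = g

/-- An ordered monoid is a (unital) quantale: all suprema exist, and the multiplication preserves
them in each variable. -/
def OrdMonoidIsQuantale (M : Type*) [Monoid M] [PartialOrder M] : Prop :=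
  (∀ S : Set M, ∃ s, IsLUB S s) ∧
    ∀ (S : Set M) (s x : M), IsLUB S s →
      IsLUB ((fun y => x * y) '' S) (x * s) ∧ IsLUB ((fun y => y * x) '' S) (s * x)

/-- A (unital) quantum B-algebra structure on a partially ordered set; `rimp x y` is `x ▹ y` and
`limp x y` is `x ◃ y`. -/
structure QuantumBAlgebra (X : Type*) [PartialOrder X] where
  rimp : X → X → X
  limp : X → X → X
  u : X
  rimp_mono : ∀ x y z, y ≤ z → rimp x y ≤ rimp x z
  limp_mono : ∀ x y z, y ≤ z → limp x y ≤ limp x z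
  le_rimp_iff : ∀ x y z, x ≤ rimp y z ↔ y ≤ limp x z
  rimp_limp : ∀ x y z, rimp x (limp y z) = limp y (rimp x z)
  u_rimp : ∀ x, rimp u x = x
  u_limp : ∀ x, limp u x = x

/-- The multicategory relation of a quantum B-algebra: `x₁ ≤ x₂ ▹ (⋯ (xₙ ▹ y))`, and `u ≤ y` for
the empty list. -/
def QuantumBAlgebra.multiLE {X : Type*} [PartialOrder X] (A : QuantumBAlgebra X) :
    List X → X → Prop
  | [], y => A.u ≤ y
  | x :: xs, y => x ≤ xs.foldr A.rimp y

/-- A morphism of quantum B-algebras. -/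
def QuantumBAlgebra.IsMorphism {X Y : Type*} [PartialOrder X] [PartialOrder Y]
    (A : QuantumBAlgebra X) (B : QuantumBAlgebra Y) (f : X → Y) : Prop :=
  Monotone f ∧ (∀ x y, f (A.rimp x y) ≤ B.rimp (f x) (f y)) ∧
    (∀ x y, f (A.limp x y) ≤ B.limp (f x) (f y)) ∧ B.u ≤ f A.u

/-- An embedding of quantum B-algebras: a morphism that reflects the multicategory relation. -/
def QuantumBAlgebra.IsEmbedding {X Y : Type*} [PartialOrder X] [PartialOrder Y]
    (A : QuantumBAlgebra X) (B : QuantumBAlgebra Y) (f : X → Y) : Prop :=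
  A.IsMorphism B f ∧ ∀ (xs : List X) (y : X), B.multiLE (xs.map f) (f y) → A.multiLE xs y

/-- A quantum B-algebra is injective (with respect to embeddings, in the category of quantum
B-algebras). -/
def QuantumBAlgebra.IsInjective {X : Type w} [PartialOrder X] (A : QuantumBAlgebra X) : Prop :=
  ∀ (Y Z : Type w) [PartialOrder Y] [PartialOrder Z] (B : QuantumBAlgebra Y)
    (C : QuantumBAlgebra Z) (i : Y → Z) (g : Y → X),
    B.IsEmbedding C i → B.IsMorphism A g → ∃ h : Z → X, C.IsMorphism A h ∧ h ∘ i = g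

/-- A quantum B-algebra is a (unital) quantale: `u` and the implications are the unit and the
residuals of a quantale multiplication for the given order. -/
def QuantumBAlgebra.IsUnitalQuantale {X : Type*} [PartialOrder X] (A : QuantumBAlgebra X) : Prop :=
  ∃ m : Monoid X, OrdMonoidIsQuantale X ∧ m.one = A.u ∧
    ∀ x y z : X, (x * y ≤ z ↔ x ≤ A.rimp y z) ∧ (x * y ≤ z ↔ y ≤ A.limp x z)

/-!
The proof shows once that, among all `(L,V)`-categories, `V`-quantales are injective and separated
injective objects are `V`-quantales, in a form that passes to every category lying fully
faithfully over `(L,V)`-categories and containing the `V`-quantales.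

*Quantales are injective* (`LVCat.IsVQuantale.exists_extension`). Given a fully faithful
`i : Y ⟶ Z` and `g : Y ⟶ Q`, the extension sends `z` to the colimit of the products
`g y₁ * ⋯ * g yₙ` weighted by `Z.hom (i y₁, …, i yₙ) z`. It is an `(L,V)`-functor because
multiplication preserves colimits, and it extends `g` because `i` is fully faithful and `Q` is
separated.

*Injectives are quantales* (`LVCat.Separated.isVQuantale_of_retraction`). An `(L,V)`-category `X`
embeds into the `V`-quantale `LVCat.presheaves` of presheaves on the free monoidal `V`-category of
lists in `X`, with the Day convolution. If `X` is injective, the Yoneda embedding `y` has a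
retraction `r`. Every presheaf `φ` satisfies `φ ≤ y (r φ)`, since `φ (x₁, …, xₙ)` is the degree to
which `y x₁ * ⋯ * y xₙ ≤ φ` and `r` is an `(L,V)`-functor. Hence `X` is reflective in its
presheaves, and products and colimits in `X` are the reflections of those of presheaves
(`LVCat.Separated.isVQuantale_of_reflection`).

Both halves combine in `injectiveAlong_iff_isVQuantale` for a full and faithful functor to
`(L,V)`-categories whose image contains all `V`-quantales. The categories of monoidal
`V`-categories, promonoidal `V`-categories, residuated monoidal `V`-categories and `V`-quantum
B-algebras are of this kind. The characterization `LVCat.isVQuantale_iff` of `V`-quantales by the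
multihom alone makes "the structure comes from a `V`-quantale" usable without transporting along
equalities of structures.

For partially ordered monoids and quantum B-algebras, `V` is the quantale of propositions. Not
every monoidal `V`-category is then a poset, so the injectivity statement is not transferred as
such; instead the embedding into presheaves (which form a poset) and the extension property of
quantales are translated directly.
-/

/-! ### Weighted colimits and `V`-quantales -/

section Colimits

variable {V : Type v} [CommMonoid V] [CompleteLattice V]

/-- `c` is the colimit of the family `f` weighted by `j : S → V`: the universal property of a
weighted colimit along a distributor from a discrete `V`-category to the point, with the infimum of
internal homs unfolded by residuation. -/
def VCat.IsColim (A : VCat.{v, w} V) {S : Type*} (j : S → V) (f : S → A.carrier)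
    (c : A.carrier) : Prop :=
  ∀ (y : A.carrier) (t : V), t ≤ A.hom c y ↔ ∀ s, t * j s ≤ A.hom (f s) y

theorem VCat.IsColim.mul_weight_le {A : VCat.{v, w} V} {S : Type*} {j : S → V}
    {f : S → A.carrier} {c : A.carrier} (h : A.IsColim j f c) (y : A.carrier) (s : S) :
    A.hom c y * j s ≤ A.hom (f s) y :=
  (h y _).1 le_rfl s

theorem VCat.IsColim.weight_le {A : VCat.{v, w} V} {S : Type*} {j : S → V}
    {f : S → A.carrier} {c : A.carrier} (h : A.IsColim j f c) (s : S) :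
    j s ≤ A.hom (f s) c := by
  have h1 := (h c 1).1 (A.one_le_hom c) s
  rwa [one_mul] at h1

theorem VCat.Separated.eq_of_hom_eq {A : VCat.{v, w} V} (hA : A.Separated) {x y : A.carrier}
    (h : ∀ z, A.hom x z = A.hom y z) : x = y :=
  hA x y (by rw [h]; exact A.one_le_hom y) (by rw [← h]; exact A.one_le_hom x)

theorem VCat.IsColim.unique {A : VCat.{v, w} V} (hA : A.Separated) {S : Type*} {j : S → V}
    {f : S → A.carrier} {c d : A.carrier} (hc : A.IsColim j f c) (hd : A.IsColim j f d) :
    c = d :=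
  hA.eq_of_hom_eq fun z => le_antisymm
    ((hd z _).2 (hc.mul_weight_le z)) ((hc z _).2 (hd.mul_weight_le z))

/-- Left adjoints preserve weighted colimits. -/
theorem VCat.IsColim.map_of_adjoint {A : VCat.{v, w} V} {B : VCat.{v, w'} V}
    {r : A.carrier → B.carrier} {y : B.carrier → A.carrier}
    (h : ∀ a b, B.hom (r a) b = A.hom a (y b)) {S : Type*} {j : S → V} {f : S → A.carrier}
    {c : A.carrier} (hc : A.IsColim j f c) : B.IsColim j (fun s => r (f s)) (r c) := by
  intro b t
  simp only [h]
  exact hc (y b) t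

theorem LVCat.ext_hom {c : Type w} {h h' : List c → c → V} {p p' q q'}
    (e : ∀ xs y, h xs y = h' xs y) : LVCat.mk (V := V) c h p q = LVCat.mk c h' p' q' := by
  obtain rfl : h = h' := funext fun xs => funext (e xs)
  rfl

variable [IsQuantale V]

theorem isWeightedColimit_iff {X Y Z : VCat.{v, w} V} (j : VDist X Z) (f : VFunctor X Y)
    (g : VFunctor Z Y) :
    IsWeightedColimit j f g ↔ ∀ z, Y.IsColim (fun x => j.rel x z) f.map (g.map z) := by
  refine forall_congr' fun z => forall_congr' fun y => ?_
  constructor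
  · intro h t
    rw [h, le_iInf_iff]
    exact forall_congr' fun _ => Quantale.leftMulResiduation_le_iff_mul_le
  · intro h
    refine eq_of_forall_le_iff fun t => ?_
    rw [h, le_iInf_iff]
    exact forall_congr' fun _ => Quantale.leftMulResiduation_le_iff_mul_le.symm

variable (V) in
/-- The discrete `V`-category on a set: `hom x y` is `1` if `x = y`, and `⊥` otherwise. -/
def VCat.discrete (S : Type w) : VCat.{v, w} V where
  carrier := S
  hom := fun x y => ⨆ _ : PLift (x = y), 1
  one_le_hom := fun x => le_iSup_of_le ⟨rfl⟩ le_rfl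
  hom_mul_hom_le := fun x y z => by
    rw [Quantale.iSup_mul_distrib]
    refine iSup_le ?_
    rintro ⟨rfl⟩
    rw [one_mul]

theorem discrete_hom_mul_le {S : Type w} {x y : S} {a b : V} (h : x = y → a ≤ b) :
    (VCat.discrete V S).hom x y * a ≤ b := by
  change (⨆ _ : PLift (x = y), (1 : V)) * a ≤ b
  rw [Quantale.iSup_mul_distrib]
  exact iSup_le fun e => by rw [one_mul]; exact h e.down

/-- A family of objects as a `V`-functor on a discrete `V`-category. -/
def VFunctor.ofFamily {A : VCat.{v, w} V} {S : Type w} (f : S → A.carrier) :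
    VFunctor (VCat.discrete V S) A where
  map := f
  hom_le := fun x y => iSup_le fun ⟨e⟩ => by subst e; exact A.one_le_hom _

/-- A family of weights as a distributor from a discrete `V`-category to the point. -/
def VDist.ofWeight {S : Type w} (j : S → V) : VDist (VCat.discrete V S) (VCat.unit.{v, w} V) where
  rel := fun s _ => j s
  hom_mul_rel_le := fun x y _ => discrete_hom_mul_le fun e => by subst e; exact le_rfl
  rel_mul_hom_le := fun x _ _ => by simp [VCat.unit]

/-- An element as a `V`-functor on the point. -/
def VFunctor.ofPoint {A : VCat.{v, w} V} (c : A.carrier) : VFunctor (VCat.unit.{v, w} V) A where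
  map := fun _ => c
  hom_le := fun _ _ => A.one_le_hom c

theorem VCat.cocomplete_iff (A : VCat.{v, w} V) :
    A.Cocomplete ↔ ∀ (S : Type w) (j : S → V) (f : S → A.carrier), ∃ c, A.IsColim j f c := by
  constructor
  · intro h S j f
    obtain ⟨g, hg⟩ := h _ _ (VFunctor.ofFamily f) (VDist.ofWeight j)
    exact ⟨g.map PUnit.unit, (isWeightedColimit_iff _ _ _).1 hg PUnit.unit⟩
  · intro h X Z f j
    choose g hg using fun z => h X.carrier (fun x => j.rel x z) f.map
    refine ⟨⟨g, fun z z' => ?_⟩, (isWeightedColimit_iff _ _ _).2 hg⟩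
    refine (hg z _ _).2 fun x => ?_
    rw [mul_comm]
    exact (j.rel_mul_hom_le x z z').trans ((hg z').weight_le x)

theorem VFunctor.cocontinuous_iff {A B : VCat.{v, w} V} (F : VFunctor A B) :
    F.Cocontinuous ↔ ∀ (S : Type w) (j : S → V) (f : S → A.carrier) (c : A.carrier),
      A.IsColim j f c → B.IsColim j (fun s => F.map (f s)) (F.map c) := by
  constructor
  · intro h S j f c hc
    have h1 := h _ _ (VFunctor.ofFamily f) (VDist.ofWeight j) (VFunctor.ofPoint c)
      ((isWeightedColimit_iff _ _ _).2 fun _ => hc)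
    exact (isWeightedColimit_iff _ _ _).1 h1 PUnit.unit
  · intro h X Z f j g hg
    exact (isWeightedColimit_iff _ _ _).2 fun z =>
      h _ _ _ _ ((isWeightedColimit_iff _ _ _).1 hg z)

/-- A cocontinuous `V`-functor on a cocomplete `V`-category has a right adjoint; its value at `y`
is the colimit of the identity weighted by `x ↦ hom (F x) y`. -/
theorem VFunctor.Cocontinuous.hasRightAdjoint {A B : VCat.{v, w} V} {F : VFunctor A B}
    (hF : F.Cocontinuous) (hA : A.Cocomplete) : F.HasRightAdjoint := by
  choose g hg using fun y => (A.cocomplete_iff.1 hA) A.carrier (fun x => B.hom (F.map x) y)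
    (fun x => x)
  have adj : ∀ x y, B.hom (F.map x) y = A.hom x (g y) := by
    refine fun x y => le_antisymm ((hg y).weight_le x) ?_
    have h1 : 1 ≤ B.hom (F.map (g y)) y :=
      (F.cocontinuous_iff.1 hF _ _ _ _ (hg y) y 1).2 fun s => by rw [one_mul]
    exact (F.hom_le _ _).trans (B.hom_le_of_right h1 _)
  refine ⟨⟨g, fun y z => ?_⟩, adj⟩
  rw [← adj]
  have h1 : 1 ≤ B.hom (F.map (g y)) y := by rw [adj]; exact A.one_le_hom _
  exact B.hom_le_of_left h1 z

/-- The underlying monoid of a monoidal `V`-category. -/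
abbrev MonVCat.monoid (Q : MonVCat.{v, w} V) : Monoid Q.carrier where
  mul x y := Q.mul.map (x, y)
  mul_assoc := Q.mul_assoc
  one := Q.one.map PUnit.unit
  one_mul := Q.one_mul
  mul_one := Q.mul_one

theorem MonVCat.listMul_eq_prod (Q : MonVCat.{v, w} V) (xs : List Q.carrier) :
    Q.listMul xs = (letI := Q.monoid; xs.prod) := by
  induction xs with
  | nil => rfl
  | cons x xs ih =>
    let := Q.monoid
    rw [List.prod_cons, ← ih]
    rfl

theorem MonVCat.listMul_singleton (Q : MonVCat.{v, w} V) (x : Q.carrier) :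
    Q.listMul [x] = x := Q.mul_one x

theorem MonVCat.listMul_pair (Q : MonVCat.{v, w} V) (x y : Q.carrier) :
    Q.listMul [x, y] = Q.mul.map (x, y) := by
  simp [MonVCat.listMul, Q.mul_one]

theorem MonVCat.isVQuantale_iff (Q : MonVCat.{v, w} V) :
    Q.IsVQuantale ↔ Q.toVCat.Separated ∧
      (∀ (S : Type w) (j : S → V) (f : S → Q.carrier), ∃ c, Q.IsColim j f c) ∧
      ∀ (S : Type w) (j : S → V) (f : S → Q.carrier) (c : Q.carrier), Q.IsColim j f c →
        ∀ x, Q.IsColim j (fun s => Q.mul.map (x, f s)) (Q.mul.map (x, c)) ∧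
          Q.IsColim j (fun s => Q.mul.map (f s, x)) (Q.mul.map (c, x)) := by
  refine and_congr_right' (and_congr (VCat.cocomplete_iff _) ?_)
  simp only [VFunctor.cocontinuous_iff]
  constructor
  · exact fun h S j f c hc x => ⟨(h x).1 S j f c hc, (h x).2 S j f c hc⟩
  · exact fun h x => ⟨fun S j f c hc => (h S j f c hc x).1, fun S j f c hc => (h S j f c hc x).2⟩

theorem MonVCat.underlying_toLVCat (Q : MonVCat.{v, w} V) : Q.toLVCat.underlying = Q.toVCat := by
  change VCat.mk _ _ _ _ = VCat.mk _ _ _ _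
  congr 1
  funext x y
  exact congrArg (Q.hom · y) (Q.listMul_singleton x)

theorem MonVCat.isColim_underlying_iff (Q : MonVCat.{v, w} V) {S : Type*} {j : S → V}
    {f : S → Q.carrier} {c : Q.carrier} :
    Q.toLVCat.underlying.IsColim j f c ↔ Q.IsColim j f c := by
  have e : ∀ x y : Q.carrier, Q.toLVCat.underlying.hom x y = Q.hom x y := fun x y =>
    congrArg (Q.hom · y) (Q.listMul_singleton x)
  exact forall_congr' fun y => forall_congr' fun t =>
    iff_congr (iff_of_eq (congrArg (t ≤ ·) (e c y)))
      (forall_congr' fun s => iff_of_eq (congrArg (t * j s ≤ ·) (e (f s) y)))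

/-- Being a `V`-quantale, expressed by the multihom alone: the `(L,V)`-category is separated, it
is represented by a monoid structure, and it has weighted colimits that multiplication
preserves. -/
theorem LVCat.isVQuantale_iff (X : LVCat.{v, w} V) :
    X.IsVQuantale ↔ X.Separated ∧
      (∀ (S : Type w) (j : S → V) (f : S → X.carrier), ∃ c, X.underlying.IsColim j f c) ∧
      ∃ _ : Monoid X.carrier, (∀ xs y, X.hom xs y = X.hom [xs.prod] y) ∧
        ∀ (S : Type w) (j : S → V) (f : S → X.carrier) (c : X.carrier),
          X.underlying.IsColim j f c →
          ∀ x, X.underlying.IsColim j (fun s => x * f s) (x * c) ∧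
            X.underlying.IsColim j (fun s => f s * x) (c * x) := by
  constructor
  · rintro ⟨Q, hQ, rfl⟩
    obtain ⟨h1, h2, h3⟩ := Q.isVQuantale_iff.1 hQ
    refine ⟨?_, fun S j f => ?_, Q.monoid, fun xs y => ?_, fun S j f c hc x => ?_⟩
    · change Q.toLVCat.underlying.Separated
      rwa [Q.underlying_toLVCat]
    · obtain ⟨c, hc⟩ := h2 S j f
      exact ⟨c, Q.isColim_underlying_iff.2 hc⟩
    · exact congrArg (Q.hom · y)
        ((Q.listMul_eq_prod xs).trans (Q.listMul_singleton _).symm)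
    · obtain ⟨h4, h5⟩ := h3 S j f c (Q.isColim_underlying_iff.1 hc) x
      exact ⟨Q.isColim_underlying_iff.2 h4, Q.isColim_underlying_iff.2 h5⟩
  · rintro ⟨h1, h2, m, hm, h3⟩
    have hpair : ∀ x y z : X.carrier, X.hom [x, y] z = X.hom [x * y] z := fun x y z => by
      rw [hm]; simp
    let Q : MonVCat.{v, w} V :=
      { carrier := X.carrier
        hom := fun x y => X.hom [x] y
        one_le_hom := X.underlying.one_le_hom
        hom_mul_hom_le := X.underlying.hom_mul_hom_le
        mul := ⟨fun p : X.carrier × X.carrier => p.1 * p.2, fun p q => by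
          have h := X.listExt_mul_hom_le [[p.1], [p.2]] [q.1, q.2] (q.1 * q.2)
          have h' : 1 ≤ X.hom [q.1, q.2] (q.1 * q.2) := by
            rw [hpair]; exact X.one_le_hom _
          have h'' := (mul_le_mul' le_rfl h').trans h
          simp only [listExt, List.flatten_cons, List.flatten_nil, mul_one] at h''
          exact h''.trans (hpair _ _ _).le⟩
        one := ⟨fun _ => (1 : X.carrier), fun _ _ => X.one_le_hom _⟩
        mul_assoc := mul_assoc
        one_mul := one_mul
        mul_one := mul_one }
    refine ⟨Q, Q.isVQuantale_iff.2 ⟨h1, h2, h3⟩, ?_⟩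
    have hl : ∀ xs : List X.carrier, Q.listMul xs = xs.prod := fun xs => by
      induction xs with
      | nil => rfl
      | cons x xs ih => rw [List.prod_cons, ← ih]; rfl
    refine LVCat.ext_hom fun xs y => ?_
    change X.hom [Q.listMul xs] y = _
    rw [hl, ← hm]

theorem MonVCat.toLVCat_isVQuantale_iff (Q : MonVCat.{v, w} V) :
    Q.toLVCat.IsVQuantale ↔ Q.IsVQuantale := by
  refine ⟨fun h => ?_, fun h => ⟨Q, h, rfl⟩⟩
  obtain ⟨h1, h2, m, hm, h3⟩ := Q.toLVCat.isVQuantale_iff.1 h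
  have hmul : ∀ x y : Q.carrier, m.mul x y = Q.mul.map (x, y) := fun x y => by
    refine h1.eq_of_hom_eq fun z => ?_
    have e : ([x, y] : List Q.toLVCat.carrier).prod = m.mul x y := List.prod_pair
    have h4 := hm [x, y] z
    rw [e] at h4
    exact h4.symm.trans (congrArg (Q.hom · z)
      ((Q.listMul_pair x y).trans (Q.listMul_singleton _).symm))
  refine Q.isVQuantale_iff.2 ⟨by rwa [← Q.underlying_toLVCat], fun S j f => ?_, ?_⟩
  · obtain ⟨c, hc⟩ := h2 S j f
    exact ⟨c, Q.isColim_underlying_iff.1 hc⟩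
  · intro S j f c hc x
    obtain ⟨h4, h5⟩ := h3 S j f c (Q.isColim_underlying_iff.2 hc) x
    simp only [← hmul]
    exact ⟨Q.isColim_underlying_iff.1 h4, Q.isColim_underlying_iff.1 h5⟩

end Colimits

/-! ### Injectivity of `V`-quantales -/

section Injectivity

variable {V : Type v} [CommMonoid V] [CompleteLattice V] [IsQuantale V]

/-- The product of a list of weighted colimits in a `V`-quantale is itself a weighted colimit. For
the inductive step it is stated behind an additional left factor `p`. -/
theorem MonVCat.le_hom_mul_listMul_of_isColim {Q : MonVCat.{v, w} V} (hQ : Q.IsVQuantale)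
    {Y Z : Type w} (j : List Y → Z → V) (g : Y → Q.carrier) (h : Z → Q.carrier)
    (hh : ∀ z, Q.IsColim (fun ys => j ys z) (fun ys => Q.listMul (ys.map g)) (h z))
    (q : Q.carrier) (t : V) (zs : List Z) (p : Q.carrier)
    (H : ∀ yss : List (List Y),
      t * listExt j yss zs ≤ Q.hom (Q.mul.map (p, Q.listMul (yss.flatten.map g))) q) :
    t ≤ Q.hom (Q.mul.map (p, Q.listMul (zs.map h))) q := by
  obtain ⟨-, -, hmul⟩ := Q.isVQuantale_iff.1 hQ
  induction zs generalizing p with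
  | nil => simpa [listExt] using H []
  | cons z zs ih =>
    rw [List.map_cons, MonVCat.listMul, ← Q.mul_assoc]
    refine ih _ fun yss => ?_
    have h1 := (hmul _ _ _ _ (hh z) p).1
    refine ((hmul _ _ _ _ h1 (Q.listMul (yss.flatten.map g))).2 _ _).2 fun ys => ?_
    have h2 := H (ys :: yss)
    simp only [listExt, List.flatten_cons, List.map_append, Q.listMul_append] at h2
    rw [← Q.mul_assoc] at h2
    rw [_root_.mul_assoc, mul_comm _ (j ys z)]
    exact h2

/-- `V`-quantales are injective: the extension of `g` along `i` sends `z` to the colimit of the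
products `g y₁ * ⋯ * g yₙ` weighted by `a((i y₁, …, i yₙ), z)`. -/
theorem LVCat.IsVQuantale.exists_extension {X Y Z : LVCat.{v, w} V} (hX : X.IsVQuantale)
    (i : Y ⟶ Z) (g : Y ⟶ X) (hi : LVCat.FullyFaithful i) : ∃ h : Z ⟶ X, i ≫ h = g := by
  obtain ⟨Q, hQ, rfl⟩ := hX
  obtain ⟨hsep, hcol, -⟩ := Q.isVQuantale_iff.1 hQ
  let g' : Y.carrier → Q.carrier := LVFunctor.map g
  let j : List Y.carrier → Z.carrier → V := fun ys z => Z.hom (ys.map (LVFunctor.map i)) z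
  have hg : ∀ ys y, Y.hom ys y ≤ Q.hom (Q.listMul (ys.map g')) (g' y) := LVFunctor.hom_le g
  choose h hh using fun z : Z.carrier =>
    hcol (List Y.carrier) (fun ys => j ys z) (fun ys => Q.listMul (ys.map g'))
  have hext : ∀ (yss : List (List Y.carrier)) (zs : List Z.carrier),
      listExt j yss zs = listExt Z.hom (yss.map (List.map (LVFunctor.map i))) zs := by
    intro yss
    induction yss with
    | nil => intro zs; cases zs <;> rfl
    | cons ys yss ih =>
      intro zs
      cases zs with
      | nil => rfl
      | cons z zs => simp only [listExt, List.map_cons, ih, j]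
  have hle : ∀ zs z, Z.hom zs z ≤ Q.hom (Q.listMul (zs.map h)) (h z) := by
    intro zs z
    rw [← Q.one_mul (Q.listMul (zs.map h))]
    refine Q.le_hom_mul_listMul_of_isColim hQ j g' h hh _ _ _ _ fun yss => ?_
    rw [Q.one_mul, mul_comm, hext]
    refine (Z.listExt_mul_hom_le _ _ _).trans ?_
    rw [← List.map_flatten]
    exact (hh z).weight_le _
  refine ⟨⟨h, hle⟩, LVFunctor.ext (funext fun y => ?_)⟩
  change h (LVFunctor.map i y) = g' y
  refine (hh _).unique hsep fun q t => ?_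
  have hj : ∀ ys, j ys (LVFunctor.map i y) = Y.hom ys y := fun ys => (hi ys y).symm
  constructor
  · intro ht ys
    simp only [hj]
    rw [mul_comm]
    exact (mul_le_mul' (hg ys y) ht).trans (Q.hom_mul_hom_le _ _ _)
  · intro ht
    have h1 := ht [y]
    simp only [List.map_cons, List.map_nil, Q.listMul_singleton, hj] at h1
    refine le_trans ?_ h1
    have h2 := mul_le_mul' (le_refl t) (Y.one_le_hom y)
    rwa [mul_one] at h2

end Injectivity

/-! ### The `V`-quantale of presheaves -/

section Presheaves

variable {V : Type v} [CommMonoid V] [CompleteLattice V] [IsQuantale V]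

/-- A presheaf on an `(L,V)`-category: a `V`-presheaf on the free monoidal `V`-category, whose
objects are the lists in `X`. -/
@[ext]
structure LVCat.Presheaf (X : LVCat.{v, w} V) where
  val : List X.carrier → V
  listExt_mul_le : ∀ xss ys, listExt X.hom xss ys * val ys ≤ val xss.flatten

namespace LVCat.Presheaf

variable {X : LVCat.{v, w} V}

/-- The degree to which one presheaf is contained in another. -/
def homV (φ ψ : X.Presheaf) : V := ⨅ xs, (φ.val xs ⇨ₗ ψ.val xs)

theorem le_homV {φ ψ : X.Presheaf} {t : V} : t ≤ homV φ ψ ↔ ∀ xs, t * φ.val xs ≤ ψ.val xs := by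
  rw [homV, le_iInf_iff]
  exact forall_congr' fun _ => Quantale.leftMulResiduation_le_iff_mul_le

theorem homV_mul_le (φ ψ : X.Presheaf) (xs : List X.carrier) :
    homV φ ψ * φ.val xs ≤ ψ.val xs :=
  le_homV.1 le_rfl xs

/-- Convolution of list-indexed families: the sum over all splittings of a list. -/
def conv (φ ψ : List X.carrier → V) (xs : List X.carrier) : V :=
  sSup {t | ∃ us vs, us ++ vs = xs ∧ t = φ us * ψ vs}

theorem conv_mul_le {φ ψ : List X.carrier → V} {xs : List X.carrier} {s t : V} :
    conv φ ψ xs * s ≤ t ↔ ∀ us vs, us ++ vs = xs → φ us * ψ vs * s ≤ t := by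
  rw [← Quantale.leftMulResiduation_le_iff_mul_le, conv, sSup_le_iff]
  constructor
  · exact fun h us vs e => Quantale.leftMulResiduation_le_iff_mul_le.1 (h _ ⟨us, vs, e, rfl⟩)
  · rintro h _ ⟨us, vs, e, rfl⟩
    exact Quantale.leftMulResiduation_le_iff_mul_le.2 (h us vs e)

theorem conv_le {φ ψ : List X.carrier → V} {xs : List X.carrier} {t : V} :
    conv φ ψ xs ≤ t ↔ ∀ us vs, us ++ vs = xs → φ us * ψ vs ≤ t := by
  simpa only [mul_one] using conv_mul_le (φ := φ) (ψ := ψ) (xs := xs) (s := 1) (t := t)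

theorem mul_le_conv (φ ψ : List X.carrier → V) (us vs : List X.carrier) :
    φ us * ψ vs ≤ conv φ ψ (us ++ vs) :=
  conv_le.1 le_rfl us vs rfl

/-- A family of multimorphisms into `us ++ vs` splits into one into `us` and one into `vs`. -/
theorem listExt_append_right (r : List X.carrier → X.carrier → V) (us vs : List X.carrier) (t : V)
    (xss : List (List X.carrier))
    (H : ∀ yss zss, yss ++ zss = xss → listExt r yss us * listExt r zss vs ≤ t) :
    listExt r xss (us ++ vs) ≤ t := by
  induction us generalizing xss t with
  | nil => simpa [listExt] using H [] xss rfl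
  | cons u us ih =>
    cases xss with
    | nil => exact bot_le
    | cons xs xss =>
      rw [List.cons_append, listExt, mul_comm, ← Quantale.leftMulResiduation_le_iff_mul_le]
      refine ih _ _ fun yss zss e => ?_
      rw [Quantale.leftMulResiduation_le_iff_mul_le]
      refine le_trans (le_of_eq ?_) (H (xs :: yss) zss (by rw [← e]; rfl))
      rw [listExt]
      ac_rfl

/-- The Day convolution of presheaves. A list of multimorphisms into `us ++ vs` splits uniquely,
so that the pointwise convolution is already a presheaf. -/
def day (φ ψ : X.Presheaf) : X.Presheaf where
  val := conv φ.val ψ.val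
  listExt_mul_le := fun xss ys => by
    rw [mul_comm, conv_mul_le]
    rintro us vs rfl
    rw [mul_comm, ← Quantale.leftMulResiduation_le_iff_mul_le]
    refine listExt_append_right _ _ _ _ _ fun yss zss e => ?_
    rw [Quantale.leftMulResiduation_le_iff_mul_le, mul_mul_mul_comm, ← e, List.flatten_append]
    exact (mul_le_mul' (φ.listExt_mul_le _ _) (ψ.listExt_mul_le _ _)).trans (mul_le_conv _ _ _ _)

/-- The unit of the Day convolution, the presheaf represented by the empty list. -/
def dayUnit : X.Presheaf where
  val := fun xs => sSup {t | xs = [] ∧ t = 1}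
  listExt_mul_le := fun xss ys => by
    rw [mul_comm, ← Quantale.leftMulResiduation_le_iff_mul_le]
    refine sSup_le ?_
    rintro _ ⟨rfl, rfl⟩
    rw [Quantale.leftMulResiduation_le_iff_mul_le, one_mul]
    cases xss with
    | nil => exact le_sSup ⟨rfl, rfl⟩
    | cons xs xss => exact bot_le

theorem dayUnit_mul_le {xs : List X.carrier} {s t : V} :
    (dayUnit (X := X)).val xs * s ≤ t ↔ (xs = [] → s ≤ t) := by
  rw [← Quantale.leftMulResiduation_le_iff_mul_le, dayUnit, sSup_le_iff]
  constructor
  · intro h e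
    have := h 1 ⟨e, rfl⟩
    rwa [Quantale.leftMulResiduation_le_iff_mul_le, one_mul] at this
  · rintro h _ ⟨e, rfl⟩
    rw [Quantale.leftMulResiduation_le_iff_mul_le, one_mul]
    exact h e

theorem one_le_dayUnit_nil : 1 ≤ (dayUnit (X := X)).val [] := le_sSup ⟨rfl, rfl⟩

theorem homV_mul_homV_le (φ ψ χ : X.Presheaf) : homV φ ψ * homV ψ χ ≤ homV φ χ := by
  refine le_homV.2 fun xs => ?_
  rw [mul_right_comm, mul_comm]
  exact (mul_le_mul' le_rfl (homV_mul_le φ ψ xs)).trans (homV_mul_le ψ χ xs)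

theorem homV_mul_homV_le_day (φ φ' ψ ψ' : X.Presheaf) :
    homV φ φ' * homV ψ ψ' ≤ homV (day φ ψ) (day φ' ψ') := by
  refine le_homV.2 fun xs => ?_
  rw [mul_comm]
  refine conv_mul_le.2 ?_
  rintro us vs rfl
  rw [mul_comm, mul_mul_mul_comm]
  exact (mul_le_mul' (homV_mul_le _ _ _) (homV_mul_le _ _ _)).trans (mul_le_conv _ _ _ _)

theorem day_assoc (φ ψ χ : X.Presheaf) : day (day φ ψ) χ = day φ (day ψ χ) := by
  ext xs
  apply le_antisymm
  · refine conv_le.2 ?_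
    rintro us vs rfl
    refine conv_mul_le.2 ?_
    rintro us us' rfl
    rw [List.append_assoc, mul_assoc]
    exact (mul_le_mul' le_rfl (mul_le_conv ψ.val χ.val _ _)).trans (mul_le_conv _ _ _ _)
  · refine conv_le.2 ?_
    rintro us vs rfl
    rw [mul_comm]
    refine conv_mul_le.2 ?_
    rintro us' us'' rfl
    rw [← List.append_assoc, mul_comm, ← mul_assoc]
    exact (mul_le_mul' (mul_le_conv φ.val ψ.val _ _) le_rfl).trans
      (mul_le_conv (day φ ψ).val _ _ _)

theorem dayUnit_day (φ : X.Presheaf) : day dayUnit φ = φ := by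
  ext xs
  apply le_antisymm
  · refine conv_le.2 fun us vs e => dayUnit_mul_le.2 ?_
    rintro rfl
    rw [← e, List.nil_append]
  · have h := mul_le_mul' (one_le_dayUnit_nil (X := X)) (le_refl (φ.val xs))
    rw [one_mul] at h
    exact h.trans (mul_le_conv _ _ [] xs)

theorem day_dayUnit (φ : X.Presheaf) : day φ dayUnit = φ := by
  ext xs
  apply le_antisymm
  · refine conv_le.2 fun us vs e => ?_
    rw [mul_comm]
    refine dayUnit_mul_le.2 ?_
    rintro rfl
    rw [← e, List.append_nil]
  · have h := mul_le_mul' (le_refl (φ.val xs)) (one_le_dayUnit_nil (X := X))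
    rw [mul_one] at h
    have h' := h.trans (mul_le_conv _ _ xs [])
    rwa [List.append_nil] at h'

/-- The colimit of presheaves, computed pointwise. -/
def colim {S : Type*} (j : S → V) (f : S → X.Presheaf) : X.Presheaf where
  val := fun xs => ⨆ s, j s * (f s).val xs
  listExt_mul_le := fun xss ys => by
    rw [Quantale.mul_iSup_distrib]
    refine iSup_mono fun s => ?_
    rw [mul_left_comm]
    exact mul_le_mul' le_rfl ((f s).listExt_mul_le _ _)

theorem le_homV_colim {S : Type*} {j : S → V} {f : S → X.Presheaf} {ψ : X.Presheaf} {t : V} :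
    t ≤ homV (colim j f) ψ ↔ ∀ s, t * j s ≤ homV (f s) ψ := by
  simp only [le_homV, colim, Quantale.mul_iSup_distrib, iSup_le_iff, mul_assoc]
  exact forall_comm

theorem day_colim {S : Type*} (j : S → V) (f : S → X.Presheaf) (φ : X.Presheaf) :
    day φ (colim j f) = colim j (fun s => day φ (f s)) := by
  refine LVCat.Presheaf.ext (funext fun xs => le_antisymm ?_ ?_)
  · refine conv_le.2 ?_
    rintro us vs rfl
    refine (Quantale.mul_iSup_distrib).le.trans (iSup_mono fun s => ?_)
    rw [mul_left_comm]
    exact mul_le_mul' le_rfl (mul_le_conv φ.val (f s).val us vs)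
  · refine iSup_le fun s => ?_
    rw [mul_comm]
    refine conv_mul_le.2 ?_
    rintro us vs rfl
    rw [mul_assoc, mul_comm _ (j s)]
    exact (mul_le_mul' le_rfl (le_iSup (fun s => j s * (f s).val vs) s)).trans
      (mul_le_conv φ.val (colim j f).val us vs)

theorem colim_day {S : Type*} (j : S → V) (f : S → X.Presheaf) (φ : X.Presheaf) :
    day (colim j f) φ = colim j (fun s => day (f s) φ) := by
  refine LVCat.Presheaf.ext (funext fun xs => le_antisymm ?_ ?_)
  · refine conv_le.2 ?_
    rintro us vs rfl
    refine (Quantale.iSup_mul_distrib).le.trans (iSup_mono fun s => ?_)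
    rw [mul_assoc]
    exact mul_le_mul' le_rfl (mul_le_conv (f s).val φ.val us vs)
  · refine iSup_le fun s => ?_
    rw [mul_comm]
    refine conv_mul_le.2 ?_
    rintro us vs rfl
    rw [mul_comm, ← mul_assoc]
    exact (mul_le_mul' (le_iSup (fun s => j s * (f s).val us) s) le_rfl).trans
      (mul_le_conv (colim j f).val φ.val us vs)

end LVCat.Presheaf

open LVCat.Presheaf

/-- The monoidal `V`-category of presheaves on an `(L,V)`-category, with the Day convolution. -/
def LVCat.presheaves (X : LVCat.{v, max w v} V) : MonVCat.{v, max w v} V where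
  carrier := X.Presheaf
  hom := homV
  one_le_hom := fun φ => le_homV.2 fun xs => (one_mul (φ.val xs)).le
  hom_mul_hom_le := homV_mul_homV_le
  mul := ⟨fun p => day p.1 p.2, fun p q => homV_mul_homV_le_day p.1 q.1 p.2 q.2⟩
  one := ⟨fun _ => dayUnit, fun _ _ => le_homV.2 fun xs => (one_mul (dayUnit.val xs)).le⟩
  mul_assoc := day_assoc
  one_mul := dayUnit_day
  mul_one := day_dayUnit

theorem LVCat.presheaves_separated (X : LVCat.{v, max w v} V) :
    X.presheaves.toVCat.Separated := fun φ ψ h h' => by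
  refine LVCat.Presheaf.ext (funext fun xs => le_antisymm ?_ ?_)
  · simpa using le_homV.1 h xs
  · simpa using le_homV.1 h' xs

theorem LVCat.isColim_colim (X : LVCat.{v, max w v} V) {S : Type*} (j : S → V)
    (f : S → X.Presheaf) : X.presheaves.IsColim j f (colim j f) :=
  fun _ _ => le_homV_colim

theorem LVCat.presheaves_isVQuantale (X : LVCat.{v, max w v} V) :
    X.presheaves.IsVQuantale := by
  refine (MonVCat.isVQuantale_iff _).2 ⟨X.presheaves_separated,
    fun S j f => ⟨colim j f, X.isColim_colim j f⟩, fun S j f c hc φ => ?_⟩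
  obtain rfl := hc.unique X.presheaves_separated (X.isColim_colim j f)
  constructor
  · exact (congrArg (X.presheaves.IsColim j _) (day_colim j f φ)).mpr (X.isColim_colim j _)
  · exact (congrArg (X.presheaves.IsColim j _) (colim_day j f φ)).mpr (X.isColim_colim j _)

/-- The representable presheaf of an object. -/
def LVCat.yonedaObj (X : LVCat.{v, max w v} V) (x : X.carrier) : X.Presheaf where
  val := fun xs => X.hom xs x
  listExt_mul_le := fun xss ys => X.listExt_mul_hom_le xss ys x

/-- The convolution of the presheaves represented by `x₁, …, xₙ` is bounded by the presheaf
represented by the list `(x₁, …, xₙ)` in the free monoidal `V`-category, whose value at `zs` is the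
supremum of `listExt X.hom zss xs` over all decompositions `zss` of `zs`. -/
theorem LVCat.listMul_yonedaObj_le (X : LVCat.{v, max w v} V) (xs zs : List X.carrier) (t : V)
    (H : ∀ zss : List (List X.carrier), zss.flatten = zs → listExt X.hom zss xs ≤ t) :
    LVCat.Presheaf.val (X.presheaves.listMul (xs.map X.yonedaObj)) zs ≤ t := by
  induction xs generalizing zs t with
  | nil =>
    have h : (dayUnit (X := X)).val zs * 1 ≤ t := dayUnit_mul_le.2 fun e => H [] e.symm
    rwa [mul_one] at h
  | cons x xs ih =>
    refine conv_le.2 ?_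
    rintro us vs rfl
    rw [mul_comm, ← Quantale.leftMulResiduation_le_iff_mul_le]
    refine ih _ _ fun zss e => ?_
    rw [Quantale.leftMulResiduation_le_iff_mul_le, mul_comm]
    exact H (us :: zss) (by rw [← e]; rfl)

theorem LVCat.one_le_listMul_yonedaObj (X : LVCat.{v, max w v} V) (xs : List X.carrier) :
    1 ≤ LVCat.Presheaf.val (X.presheaves.listMul (xs.map X.yonedaObj)) xs := by
  induction xs with
  | nil => exact one_le_dayUnit_nil
  | cons x xs ih =>
    have h := mul_le_mul' (X.one_le_hom x) ih
    rw [one_mul] at h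
    exact h.trans (mul_le_conv (X.yonedaObj x).val _ [x] xs)

/-- The Yoneda lemma. -/
theorem LVCat.hom_listMul_yonedaObj (X : LVCat.{v, max w v} V) (xs : List X.carrier)
    (φ : X.Presheaf) :
    X.presheaves.hom (X.presheaves.listMul (xs.map X.yonedaObj)) φ = φ.val xs := by
  apply le_antisymm
  · have h := mul_le_mul' (le_refl (homV (X.presheaves.listMul (xs.map X.yonedaObj)) φ))
      (X.one_le_listMul_yonedaObj xs)
    rw [mul_one] at h
    exact h.trans (homV_mul_le _ _ _)
  · refine le_homV.2 fun zs => ?_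
    rw [mul_comm, ← Quantale.leftMulResiduation_le_iff_mul_le]
    refine X.listMul_yonedaObj_le _ _ _ fun zss e => ?_
    rw [Quantale.leftMulResiduation_le_iff_mul_le, ← e]
    exact φ.listExt_mul_le _ _

/-- The Yoneda embedding of an `(L,V)`-category into its `V`-quantale of presheaves. -/
def LVCat.yoneda (X : LVCat.{v, max w v} V) : X ⟶ X.presheaves.toLVCat :=
  LVFunctor.mk X.yonedaObj fun xs x => (X.hom_listMul_yonedaObj xs (X.yonedaObj x)).ge

theorem LVCat.yoneda_fullyFaithful (X : LVCat.{v, max w v} V) :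
    LVCat.FullyFaithful X.yoneda :=
  fun xs x => (X.hom_listMul_yonedaObj xs (X.yonedaObj x)).symm

end Presheaves

/-! ### Reflections and retracts of `V`-quantales -/

section Retracts

variable {V : Type v} [CommMonoid V] [CompleteLattice V] [IsQuantale V]

theorem MonVCat.one_le_hom_listMul (Q : MonVCat.{v, w} V) {Y : Type*} (xs : List Y)
    (f g : Y → Q.carrier) (h : ∀ x, 1 ≤ Q.hom (f x) (g x)) :
    1 ≤ Q.hom (Q.listMul (xs.map f)) (Q.listMul (xs.map g)) := by
  induction xs with
  | nil => exact Q.one_le_hom _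
  | cons x xs ih =>
    have h1 := mul_le_mul' (h x) ih
    rw [_root_.one_mul] at h1
    exact h1.trans (Q.mul.hom_le (f x, Q.listMul (xs.map f)) (g x, Q.listMul (xs.map g)))

section Reflection

variable {X : LVCat.{v, w} V} {Q : MonVCat.{v, w} V} {y : X.carrier → Q.carrier}
  {r : Q.carrier → X.carrier}

/-- The multicategorical adjointness between a fully faithful `y` and a retraction `r` of it with
a unit. -/
theorem LVCat.hom_map_eq_of_reflection
    (hy : ∀ xs x, X.hom xs x = Q.hom (Q.listMul (xs.map y)) (y x))
    (hr : ∀ qs q, Q.hom (Q.listMul qs) q ≤ X.hom (qs.map r) (r q)) (hry : ∀ x, r (y x) = x)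
    (hunit : ∀ q, 1 ≤ Q.hom q (y (r q))) (qs : List Q.carrier) (x : X.carrier) :
    X.hom (qs.map r) x = Q.hom (Q.listMul qs) (y x) := by
  apply le_antisymm
  · have h1 := Q.one_le_hom_listMul qs (fun q => q) (fun q => y (r q)) hunit
    rw [List.map_id_fun'] at h1
    refine le_trans (le_of_eq ?_) (Q.hom_le_of_left h1 _)
    rw [hy, List.map_map]
    rfl
  · have h := hr qs (y x)
    rwa [hry] at h

/-- A separated `(L,V)`-category that is reflective in a `V`-quantale `Q`, with inclusion `y` and
reflection `r`, is a `V`-quantale: products and colimits are the reflections of those in `Q`. -/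
theorem LVCat.Separated.isVQuantale_of_reflection (hX : X.Separated) (hQ : Q.IsVQuantale)
    (hy : ∀ xs x, X.hom xs x = Q.hom (Q.listMul (xs.map y)) (y x))
    (hr : ∀ qs q, Q.hom (Q.listMul qs) q ≤ X.hom (qs.map r) (r q)) (hry : ∀ x, r (y x) = x)
    (hunit : ∀ q, 1 ≤ Q.hom q (y (r q))) : X.IsVQuantale := by
  have hlist := LVCat.hom_map_eq_of_reflection hy hr hry hunit
  have hadj : ∀ q x, X.hom [r q] x = Q.hom q (y x) := fun q x => by
    have h := hlist [q] x
    rwa [Q.listMul_singleton] at h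
  -- `r` is multiplicative: both sides represent the multimorphisms out of `(r p, r q)`
  have hpair : ∀ p q x, X.hom [r (Q.mul.map (p, q))] x = X.hom [r p, r q] x := fun p q x =>
    (hadj _ x).trans
      ((congrArg (Q.hom · (y x)) (Q.listMul_pair p q)).symm.trans (hlist [p, q] x).symm)
  have hmul : ∀ p q, r (Q.mul.map (y (r p), y (r q))) = r (Q.mul.map (p, q)) := fun p q => by
    refine hX.eq_of_hom_eq fun x => ((hpair _ _ x).trans ?_).trans (hpair p q x).symm
    rw [hry, hry]
  let mul : X.carrier → X.carrier → X.carrier := fun x x' => r (Q.mul.map (y x, y x'))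
  have hmul₁ : ∀ x q, mul x (r q) = r (Q.mul.map (y x, q)) := fun x q => by
    have h := hmul (y x) q
    rwa [hry] at h
  have hmul₂ : ∀ q x, mul (r q) x = r (Q.mul.map (q, y x)) := fun q x => by
    have h := hmul q (y x)
    rwa [hry] at h
  let m : Monoid X.carrier :=
    { mul := mul
      one := r (Q.one.map PUnit.unit)
      mul_assoc := fun x x' x'' => (hmul₂ _ _).trans
        ((congrArg r (Q.mul_assoc _ _ _)).trans (hmul₁ _ _).symm)
      one_mul := fun x => (hmul₂ _ _).trans ((congrArg r (Q.one_mul _)).trans (hry x))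
      mul_one := fun x => (hmul₁ _ _).trans ((congrArg r (Q.mul_one _)).trans (hry x)) }
  obtain ⟨-, hcol, hQmul⟩ := Q.isVQuantale_iff.1 hQ
  have hrcol : ∀ {S : Type w} {j : S → V} {f : S → Q.carrier} {c : Q.carrier},
      Q.IsColim j f c → X.underlying.IsColim j (fun s => r (f s)) (r c) := fun hc =>
    VCat.IsColim.map_of_adjoint (B := X.underlying) hadj hc
  -- colimits in `X` are computed by reflecting the colimits in `Q`
  have hcolX : ∀ {S : Type w} (j : S → V) (f : S → X.carrier), ∃ d,
      Q.IsColim j (fun s => y (f s)) d ∧ X.underlying.IsColim j f (r d) := fun {S} j f => by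
    obtain ⟨d, hd⟩ := hcol S j fun s => y (f s)
    refine ⟨d, hd, ?_⟩
    have h := hrcol hd
    simp only [hry] at h
    exact h
  refine X.isVQuantale_iff.2 ⟨hX, fun S j f => ?_, m, fun xs x => ?_, fun S j f c hc x => ?_⟩
  · obtain ⟨d, -, hd⟩ := hcolX j f
    exact ⟨r d, hd⟩
  · have hprod : xs.prod = r (Q.listMul (xs.map y)) := by
      induction xs with
      | nil => rfl
      | cons x xs ih =>
        rw [List.prod_cons, ih]
        exact hmul₁ x (Q.listMul (xs.map y))
    rw [hprod, hadj]
    exact hy xs x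
  · obtain ⟨d, hd, hd'⟩ := hcolX j f
    obtain rfl := hc.unique hX hd'
    obtain ⟨h1, h2⟩ := hQmul S j _ d hd (y x)
    have h3 := hrcol h1
    have h4 := hrcol h2
    rw [← hmul₁] at h3
    rw [← hmul₂] at h4
    exact ⟨h3, h4⟩

end Reflection

/-- A retraction of the Yoneda embedding is left adjoint to it, and so its existence makes a
separated `(L,V)`-category a `V`-quantale. -/
theorem LVCat.Separated.isVQuantale_of_retraction {X : LVCat.{v, max w v} V}
    (hX : X.Separated) (r : X.presheaves.toLVCat ⟶ X) (hr : X.yoneda ≫ r = 𝟙 X) :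
    X.IsVQuantale := by
  let r' : X.Presheaf → X.carrier := LVFunctor.map r
  have hry : ∀ x, r' (X.yonedaObj x) = x := fun x => congrFun (congrArg LVFunctor.map hr) x
  refine hX.isVQuantale_of_reflection X.presheaves_isVQuantale X.yoneda_fullyFaithful
    (LVFunctor.hom_le r) hry fun φ => LVCat.Presheaf.le_homV.2 fun xs => ?_
  -- the unit `φ ≤ y (r φ)`: the value of `φ` at `xs` is the degree to which `y xs ≤ φ`
  rw [_root_.one_mul, ← X.hom_listMul_yonedaObj xs φ]
  have h : X.presheaves.hom (X.presheaves.listMul (xs.map X.yonedaObj)) φ ≤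
      X.hom ((xs.map X.yonedaObj).map r') (r' φ) := LVFunctor.hom_le r _ _
  have e : (xs.map X.yonedaObj).map r' = xs := by
    rw [List.map_map]
    exact (List.map_congr_left fun x _ => hry x).trans (List.map_id xs)
  exact h.trans_eq (congrArg (X.hom · (r' φ)) e)

/-- Every separated `(L,V)`-category embeds into a `V`-quantale in such a way that it is itself a
`V`-quantale as soon as the embedding has a retraction. -/
theorem LVCat.Separated.exists_retract_test {X : LVCat.{v, max w v} V} (hX : X.Separated) :
    ∃ Q : MonVCat.{v, max w v} V, Q.IsVQuantale ∧ ∃ i : X ⟶ Q.toLVCat,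
      LVCat.FullyFaithful i ∧ ∀ r, i ≫ r = 𝟙 X → X.IsVQuantale :=
  ⟨X.presheaves, X.presheaves_isVQuantale, X.yoneda, X.yoneda_fullyFaithful,
    fun r hr => hX.isVQuantale_of_retraction r hr⟩

end Retracts

/-! ### Categories over `(L,V)`-categories -/

section Subcategories

variable {V : Type v} [CommMonoid V] [CompleteLattice V] [IsQuantale V]

/-- The characterization of injectivity in a category that is fully faithful over
`(L,V)`-categories and whose image contains all `V`-quantales: `V`-quantales are injective among
all `(L,V)`-categories, and an injective object is a retract of its presheaf quantale. -/
theorem injectiveAlong_iff_isVQuantale {D : Type*} [Category D]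
    (F : D ⥤ LVCat.{v, max w v} V) [F.Full] [F.Faithful]
    (hF : ∀ Q : MonVCat.{v, max w v} V, Q.IsVQuantale → ∃ Z, F.obj Z = Q.toLVCat)
    (X : D) (hX : (F.obj X).Separated) :
    InjectiveAlong F X ↔ (F.obj X).IsVQuantale := by
  constructor
  · intro h
    obtain ⟨Q, hQ, hQ'⟩ := hX.exists_retract_test
    obtain ⟨Z, hZ⟩ := hF Q hQ
    rw [← hZ] at hQ'
    obtain ⟨i, hi, hr⟩ := hQ'
    obtain ⟨r, hr'⟩ := h (F.preimage i) (𝟙 X) (by rwa [F.map_preimage])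
    refine hr (F.map r) ?_
    rw [← F.map_preimage i, ← F.map_comp, hr', F.map_id]
  · intro h Y Z i g hi
    obtain ⟨e, he⟩ := h.exists_extension (F.map i) (F.map g) hi
    exact ⟨F.preimage e, F.map_injective (by rw [F.map_comp, F.map_preimage, he])⟩

instance kmp_faithful : (kmp.{v, w} V).Faithful where
  map_injective {X Y} f g h := by
    refine LaxMonFunctor.ext ?_
    exact congrArg LVFunctor.map h

instance kmp_full : (kmp.{v, w} V).Full where
  map_surjective {X Y} f := by
    let f' : X.carrier → Y.carrier := LVFunctor.map f
    have hf : ∀ xs y, X.hom (X.listMul xs) y ≤ Y.hom (Y.listMul (xs.map f')) (f' y) :=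
      LVFunctor.hom_le f
    refine ⟨LaxMonFunctor.mk ⟨f', fun x y => ?_⟩ ?_ fun x y => ?_, rfl⟩
    · have h := hf [x] y
      rwa [List.map_cons, List.map_nil, X.listMul_singleton, Y.listMul_singleton] at h
    · exact (X.one_le_hom _).trans (hf [] _)
    · have h := hf [x, y] (X.mul.map (x, y))
      rw [List.map_cons, List.map_cons, List.map_nil, X.listMul_pair, Y.listMul_pair] at h
      exact (X.one_le_hom _).trans h

instance proToLVCat_faithful : (proToLVCat.{v, w} V).Faithful where
  map_injective {X Y} f g h := by
    refine ProFunctor.ext ?_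
    exact congrArg LVFunctor.map h

instance proToLVCat_full : (proToLVCat.{v, w} V).Full where
  map_surjective {X Y} f := by
    have hf : ∀ xs y, X.multiHom xs y ≤
      Y.multiHom (xs.map (LVFunctor.map f)) (LVFunctor.map f y) := LVFunctor.hom_le f
    exact ⟨ProFunctor.mk ⟨LVFunctor.map f, fun x y => hf [x] y⟩ (fun x y z => hf [x, y] z)
      (fun x => hf [] x), rfl⟩

instance qbToPro_faithful : (qbToPro.{v, w} V).Faithful where
  map_injective {X Y} f g h := by
    refine QBFunctor.ext ?_
    exact congrArg (fun k : ProFunctor X.toVPro Y.toVPro => k.map) h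

/-- Preservation of the promonoidal structure gives the lax preservation of `▹`, `◃` and `u`, by
evaluating it at the universal elements of the representable distributors. -/
instance qbToPro_full : (qbToPro.{v, w} V).Full where
  map_surjective {X Y} f := by
    have hP : ∀ x y z, X.P.rel (x, y) z ≤ _ := ProFunctor.P_le f
    have hJ : ∀ x, X.J.rel PUnit.unit x ≤ _ := ProFunctor.J_le f
    refine ⟨QBFunctor.mk f.toVFunctor (fun x y => ?_) (fun x y => ?_) ?_, rfl⟩
    · rw [← Y.P_eq_rimp]
      refine le_trans ?_ (hP _ _ _)
      rw [X.P_eq_rimp]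
      exact X.one_le_hom _
    · rw [← Y.P_eq_limp]
      refine le_trans ?_ (hP _ _ _)
      rw [X.P_eq_limp]
      exact X.one_le_hom _
    · rw [← Y.J_eq]
      refine le_trans ?_ (hJ _)
      rw [X.J_eq]
      exact X.one_le_hom _

/-- The co-Yoneda formula for composition with a representable distributor. -/
theorem VFunctor.iSup_hom_mul_hom_map {A B : VCat.{v, w} V} (F : VFunctor A B) (a : A.carrier)
    (b : B.carrier) : ⨆ x, A.hom a x * B.hom (F.map x) b = B.hom (F.map a) b := by
  apply le_antisymm
  · exact iSup_le fun x => (mul_le_mul' (F.hom_le _ _) le_rfl).trans (B.hom_mul_hom_le _ _ _)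
  · refine le_trans ?_ (le_iSup (fun x => A.hom a x * B.hom (F.map x) b) a)
    have h := mul_le_mul' (A.one_le_hom a) (le_refl (B.hom (F.map a) b))
    rwa [_root_.one_mul] at h

/-- A monoidal `V`-category as a promonoidal one, with `P x y z = hom (x * y) z` and
`J x = hom 1 x`. -/
def MonVCat.toVPro (Q : MonVCat.{v, w} V) : VPro.{v, w} V where
  toVCat := Q.toVCat
  P :=
    { rel := fun p z => Q.hom (Q.mul.map p) z
      hom_mul_rel_le := fun p q z =>
        (mul_le_mul' (Q.mul.hom_le p q) le_rfl).trans (Q.hom_mul_hom_le _ _ _)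
      rel_mul_hom_le := fun _ _ _ => Q.hom_mul_hom_le _ _ _ }
  J :=
    { rel := fun p z => Q.hom (Q.one.map p) z
      hom_mul_rel_le := fun _ _ _ => (_root_.one_mul _).le
      rel_mul_hom_le := fun _ _ _ => Q.hom_mul_hom_le _ _ _ }
  assoc := fun a b c d => by
    refine Eq.trans (b := Q.hom (Q.listMul [a, b, c]) d) ?_ ?_ <;>
      simp only [MonVCat.listMul, Q.mul_one]
    · rw [← Q.mul_assoc]
      exact (Q.mulRight c).iSup_hom_mul_hom_map (Q.mul.map (a, b)) d
    · exact ((Q.mulLeft a).iSup_hom_mul_hom_map (Q.mul.map (b, c)) d).symm.trans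
        (iSup_congr fun x => mul_comm _ _)
  left_unit := fun x y => by
    refine ((Q.mulRight x).iSup_hom_mul_hom_map _ y).trans ?_
    exact congrArg (Q.hom · y) (Q.one_mul x)
  right_unit := fun x y => by
    refine ((Q.mulLeft x).iSup_hom_mul_hom_map _ y).trans ?_
    exact congrArg (Q.hom · y) (Q.mul_one x)

theorem MonVCat.toLVCat_toVPro (Q : MonVCat.{v, w} V) : Q.toVPro.toLVCat = Q.toLVCat := by
  refine LVCat.ext_hom fun xs y => ?_
  induction xs generalizing y with
  | nil => rfl
  | cons x xs ih =>
    rw [VPro.multiHom_cons]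
    refine Eq.trans (iSup_congr fun z => congrArg (· * _) (ih z)) ?_
    exact (Q.mulLeft x).iSup_hom_mul_hom_map (Q.listMul xs) y

theorem MonVCat.IsVQuantale.isResiduated {Q : MonVCat.{v, w} V} (hQ : Q.IsVQuantale) :
    Q.IsResiduated :=
  fun x => ⟨(hQ.2.2 x).1.hasRightAdjoint hQ.2.1, (hQ.2.2 x).2.hasRightAdjoint hQ.2.1⟩

theorem MonVCat.IsResiduated.exists_vqbAlg {Q : MonVCat.{v, w} V} (hQ : Q.IsResiduated) :
    ∃ Z : VQBAlg.{v, w} V, Z.toVPro = Q.toVPro := by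
  choose l hl using fun x => (hQ x).1
  choose r hr using fun x => (hQ x).2
  exact ⟨{ Q.toVPro with
    rimp := fun x y => (r x).map y
    limp := fun x y => (l x).map y
    u := Q.one.map PUnit.unit
    P_eq_limp := fun x z y => hl x z y
    P_eq_rimp := fun z x y => hr x z y
    J_eq := fun _ => rfl }, rfl⟩

end Subcategories

/-! ### Partially ordered monoids and quantum B-algebras -/

section Ordered

/-- The two-element quantale: propositions, ordered by implication, with conjunction as
multiplication. -/
def Two : Type := Prop

instance Two.completeLattice : CompleteLattice Two := inferInstanceAs (CompleteLattice Prop)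

instance Two.commMonoid : CommMonoid Two where
  mul p q := And p q
  mul_assoc _ _ _ := propext and_assoc
  one := True
  one_mul _ := propext (iff_of_eq (true_and _))
  mul_one _ := propext (iff_of_eq (and_true _))
  mul_comm _ _ := propext and_comm

instance Two.isQuantale : IsQuantale Two where
  mul_sSup_distrib x s := by
    apply le_antisymm
    · rintro ⟨hx, y, hy, h⟩
      exact (le_iSup₂ (f := fun y (_ : y ∈ s) => x * y) y hy : _ ≤ _) ⟨hx, h⟩
    · exact iSup₂_le fun y hy h => ⟨h.1, (le_sSup hy : y ≤ sSup s) h.2⟩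
  sSup_mul_distrib s x := by
    apply le_antisymm
    · rintro ⟨⟨y, hy, h⟩, hx⟩
      exact (le_iSup₂ (f := fun y (_ : y ∈ s) => y * x) y hy : _ ≤ _) ⟨h, hx⟩
    · exact iSup₂_le fun y hy h => ⟨(le_sSup hy : y ≤ sSup s) h.1, h.2⟩

theorem Two.eq_of_iff {p q : Two} (h : (p : Prop) ↔ (q : Prop)) : p = q := propext h

/-- A partially ordered monoid as a monoidal category enriched in the two-element quantale. -/
def ordMon (M : Type w) [Monoid M] [PartialOrder M] [MulLeftMono M] [MulRightMono M] :
    MonVCat.{0, w} Two where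
  carrier := M
  hom x y := (x ≤ y : Prop)
  one_le_hom x := fun _ => le_refl x
  hom_mul_hom_le _ _ _ := fun h => le_trans h.1 h.2
  mul := ⟨fun p : M × M => p.1 * p.2, fun _ _ h => mul_le_mul' h.1 h.2⟩
  one := ⟨fun _ => (1 : M), fun _ _ _ => le_refl (1 : M)⟩
  mul_assoc := mul_assoc
  one_mul := one_mul
  mul_one := mul_one

section OrderedMonoids

variable {M N : Type w} [Monoid M] [PartialOrder M] [MulLeftMono M] [MulRightMono M]
  [Monoid N] [PartialOrder N] [MulLeftMono N] [MulRightMono N]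

theorem ordMon_listMul (xs : List M) : (ordMon M).listMul xs = xs.prod := by
  induction xs with
  | nil => rfl
  | cons x xs ih => rw [List.prod_cons, ← ih]; rfl

theorem ordMon_hom_iff (xs : List M) (y : M) :
    ((ordMon M).toLVCat.hom xs y : Prop) ↔ xs.prod ≤ y := by
  rw [← ordMon_listMul]
  exact Iff.rfl

theorem ordMon_separated : (ordMon M).toVCat.Separated :=
  fun (x y : M) h h' => le_antisymm (α := M) (a := x) (b := y) (h trivial) (h' trivial)

theorem ordMon_toLVCat_separated : (ordMon M).toLVCat.Separated := by
  rw [LVCat.Separated, MonVCat.underlying_toLVCat]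
  exact ordMon_separated

theorem ordMon_isColim_iff {S : Type*} {j : S → Two} {f : S → M} {c : M} :
    (ordMon M).IsColim j f c ↔ IsLUB (f '' {s | (j s : Prop)}) c := by
  rw [isLUB_iff_le_iff]
  constructor
  · intro h y
    constructor
    · rintro hc _ ⟨s, hs, rfl⟩
      exact (h y True).1 (fun _ => hc) s ⟨trivial, hs⟩
    · intro hy
      exact (h y True).2 (fun s hs => hy ⟨s, hs.2, rfl⟩) trivial
  · intro h y t
    constructor
    · intro ht s hs
      exact (h y).1 (ht hs.1) ⟨s, hs.2, rfl⟩
    · intro ht p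
      refine (h y).2 ?_
      rintro _ ⟨s, hs, rfl⟩
      exact ht s ⟨p, hs⟩

theorem ordMon_isVQuantale_iff : (ordMon M).IsVQuantale ↔ OrdMonoidIsQuantale M := by
  rw [MonVCat.isVQuantale_iff, and_iff_right ordMon_separated]
  have himage : ∀ {S : Type w} (j : S → Two) (f : S → M) (g : M → M),
      (fun s => g (f s)) '' {s | (j s : Prop)} = g '' (f '' {s | (j s : Prop)}) :=
    fun j f g => (Set.image_image g f _).symm
  have hset : ∀ S : Set M, ((↑) : S → M) '' {_s | (True : Prop)} = S := fun S => by simp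
  constructor
  · rintro ⟨h1, h2⟩
    refine ⟨fun S => ?_, fun S s x hs => ?_⟩
    · obtain ⟨c, hc⟩ := h1 S (fun _ => True) fun s => (s : M)
      refine ⟨c, ?_⟩
      rw [← hset S]
      exact ordMon_isColim_iff.1 hc
    · rw [← hset S] at hs
      obtain ⟨h3, h4⟩ := h2 S (fun _ => True) (fun s => (s : M)) s (ordMon_isColim_iff.2 hs) x
      have h3 := ordMon_isColim_iff.1 h3
      have h4 := ordMon_isColim_iff.1 h4
      rw [← hset S, ← himage (fun _ => True) _ fun y => x * y,
        ← himage (fun _ => True) _ fun y => y * x]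
      exact ⟨h3, h4⟩
  · rintro ⟨h1, h2⟩
    refine ⟨fun S j f => ?_, fun S j f c hc (x : M) => ?_⟩
    · obtain ⟨c, hc⟩ := h1 (f '' {s | (j s : Prop)})
      exact ⟨c, ordMon_isColim_iff.2 hc⟩
    · obtain ⟨h3, h4⟩ := h2 _ _ x (ordMon_isColim_iff.1 hc)
      rw [← himage j f fun y => x * y] at h3
      rw [← himage j f fun y => y * x] at h4
      exact ⟨ordMon_isColim_iff.2 h3, ordMon_isColim_iff.2 h4⟩

/-- Submultiplicative monotone maps as `(L,V)`-functors. -/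
def IsSubmultiplicative.toLVFunctor {f : M → N} (hf : IsSubmultiplicative f) :
    (ordMon M).toLVCat ⟶ (ordMon N).toLVCat :=
  (kmp Two).map (X := ordMon M) (Y := ordMon N)
    (LaxMonFunctor.mk ⟨f, fun _ _ h => hf.1 h⟩ (fun _ => hf.2.2) fun x y _ => hf.2.1 x y)

theorem isSubmultiplicative_map (f : (ordMon M).toLVCat ⟶ (ordMon N).toLVCat) :
    IsSubmultiplicative (M := M) (N := N) (LVFunctor.map f) := by
  let f' : M → N := LVFunctor.map f
  have h : ∀ (xs : List M) (y : M), xs.prod ≤ y → (xs.map f').prod ≤ f' y := fun xs y hxs =>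
    (ordMon_hom_iff _ _).1 (LVFunctor.hom_le f xs y ((ordMon_hom_iff _ _).2 hxs))
  refine ⟨fun x y hxy => ?_, fun x y => ?_, h [] 1 le_rfl⟩
  · simpa using h [x] y (by simpa using hxy)
  · simpa using h [x, y] (x * y) (by simp)

theorem IsOrdMonoidEmbedding.fullyFaithful {f : M → N} (hf : IsOrdMonoidEmbedding f) :
    LVCat.FullyFaithful hf.1.toLVFunctor :=
  fun xs x => le_antisymm (LVFunctor.hom_le hf.1.toLVFunctor xs x) fun h =>
    (ordMon_hom_iff _ _).2 (hf.2 xs x ((ordMon_hom_iff (xs.map f) (f x)).1 h))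

theorem isOrdMonoidEmbedding_map {f : (ordMon M).toLVCat ⟶ (ordMon N).toLVCat}
    (hf : LVCat.FullyFaithful f) : IsOrdMonoidEmbedding (M := M) (N := N) (LVFunctor.map f) :=
  ⟨isSubmultiplicative_map f, fun xs x h =>
    (ordMon_hom_iff _ _).1 ((hf xs x).ge ((ordMon_hom_iff _ _).2 h))⟩

end OrderedMonoids

/-- A separated monoidal category enriched in the two-element quantale is a partially ordered
monoid. -/
theorem MonVCat.exists_ordMon (Q : MonVCat.{0, w} Two) (hQ : Q.toVCat.Separated) :
    ∃ (N : Type w) (_ : Monoid N) (_ : PartialOrder N) (_ : MulLeftMono N) (_ : MulRightMono N),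
      (ordMon N).toLVCat = Q.toLVCat := by
  let m : Monoid Q.carrier := Q.monoid
  let o : PartialOrder Q.carrier :=
    { le := fun x y => Q.hom x y
      le_refl := fun x => Q.one_le_hom x trivial
      le_trans := fun x y z h h' => Q.hom_mul_hom_le x y z ⟨h, h'⟩
      le_antisymm := fun x y h h' => hQ x y (fun _ => h) (fun _ => h') }
  have hl : MulLeftMono Q.carrier := ⟨fun x _ _ h => (Q.mulLeft x).hom_le _ _ h⟩
  have hr : MulRightMono Q.carrier := ⟨fun x _ _ h => (Q.mulRight x).hom_le _ _ h⟩
  refine ⟨Q.carrier, m, o, hl, hr, LVCat.ext_hom fun xs y => ?_⟩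
  exact congrArg (Q.hom · y) ((ordMon_listMul (M := Q.carrier) xs).trans
    (Q.listMul_eq_prod xs).symm)

namespace QuantumBAlgebra

variable {X : Type w} [PartialOrder X] (A : QuantumBAlgebra X)

theorem u_le_rimp_iff {x y : X} : A.u ≤ A.rimp x y ↔ x ≤ y := by
  rw [A.le_rimp_iff, A.u_limp]

/-- The multicategory relation in a form that is uniform in the length of the list. -/
theorem multiLE_iff (xs : List X) (y : X) : A.multiLE xs y ↔ A.u ≤ xs.foldr A.rimp y := by
  cases xs with
  | nil => exact Iff.rfl
  | cons x xs => exact A.u_le_rimp_iff.symm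

theorem foldr_rimp_mono (xs : List X) {y z : X} (h : y ≤ z) :
    xs.foldr A.rimp y ≤ xs.foldr A.rimp z := by
  induction xs with
  | nil => exact h
  | cons x xs ih => exact A.rimp_mono _ _ _ ih

theorem foldr_rimp_limp (xs : List X) (y z : X) :
    xs.foldr A.rimp (A.limp y z) = A.limp y (xs.foldr A.rimp z) := by
  induction xs with
  | nil => rfl
  | cons x xs ih => rw [List.foldr_cons, ih, A.rimp_limp, List.foldr_cons]

/-- Replacing `y` by a list that lies below it enlarges `y ▹ z`; iterating this gives the
composition law of the multicategory relation. -/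
theorem rimp_le_foldr_rimp {xs : List X} {y : X} (h : A.multiLE xs y) (z : X) :
    A.rimp y z ≤ xs.foldr A.rimp z := by
  rw [multiLE_iff] at h
  -- `y ≤ (y ▹ z) ◃ z`, so that `u ≤ xs ▹ ((y ▹ z) ◃ z) = (y ▹ z) ◃ (xs ▹ z)`
  have h1 : y ≤ A.limp (A.rimp y z) z := (A.le_rimp_iff _ _ _).1 le_rfl
  have h2 := h.trans (A.foldr_rimp_mono xs h1)
  rwa [foldr_rimp_limp, ← A.le_rimp_iff, A.u_rimp] at h2

/-- The `(L,V)`-category of a quantum B-algebra, for the two-element quantale. -/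
def toLVCat : LVCat.{0, w} Two where
  carrier := X
  hom xs y := A.multiLE xs y
  one_le_hom x := fun _ => le_refl x
  listExt_mul_hom_le xss ys z := by
    have key : ∀ (xss : List (List X)) (ys : List X),
        (listExt (V := Two) (fun xs y => A.multiLE xs y) xss ys : Prop) →
        ys.foldr A.rimp z ≤ xss.flatten.foldr A.rimp z := by
      intro xss
      induction xss with
      | nil =>
        intro ys h
        cases ys with
        | nil => exact le_rfl
        | cons y ys => exact h.elim
      | cons xs xss ih =>
        intro ys h
        cases ys with
        | nil => exact h.elim
        | cons y ys =>
          rw [List.flatten_cons, List.foldr_append]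
          exact (A.rimp_le_foldr_rimp h.1 _).trans (A.foldr_rimp_mono xs (ih ys h.2))
    intro h
    exact (A.multiLE_iff _ _).2 (((A.multiLE_iff _ _).1 h.2).trans (key xss ys h.1))

theorem toLVCat_separated : A.toLVCat.Separated :=
  fun (x y : X) h h' => le_antisymm (α := X) (a := x) (b := y) (h trivial) (h' trivial)

variable {A} {Y : Type w} [PartialOrder Y] {B : QuantumBAlgebra Y}

/-- Morphisms of quantum B-algebras as `(L,V)`-functors. -/
def IsMorphism.toLVFunctor {f : X → Y} (hf : A.IsMorphism B f) : A.toLVCat ⟶ B.toLVCat :=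
  LVFunctor.mk f fun xs y h => by
    obtain ⟨hmono, hrimp, -, hu⟩ := hf
    have key : ∀ xs : List X, f (xs.foldr A.rimp y) ≤ (xs.map f).foldr B.rimp (f y) := by
      intro xs
      induction xs with
      | nil => exact le_rfl
      | cons x xs ih => exact (hrimp _ _).trans (B.rimp_mono _ _ _ ih)
    exact (B.multiLE_iff _ _).2 ((hu.trans (hmono ((A.multiLE_iff _ _).1 h))).trans (key xs))

theorem isMorphism_map (f : A.toLVCat ⟶ B.toLVCat) :
    A.IsMorphism B (LVFunctor.map f : X → Y) := by
  let f' : X → Y := LVFunctor.map f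
  have h : ∀ (xs : List X) (y : X), A.multiLE xs y → B.multiLE (xs.map f') (f' y) :=
    LVFunctor.hom_le f
  refine ⟨fun x y => h [x] y, fun x y => h [A.rimp x y, x] y le_rfl, fun x y => ?_,
    h [] A.u le_rfl⟩
  have hx : A.multiLE [x, A.limp x y] y := (A.le_rimp_iff _ _ _).2 le_rfl
  exact (B.le_rimp_iff _ _ _).1 (h _ _ hx)

theorem IsEmbedding.fullyFaithful {f : X → Y} (hf : A.IsEmbedding B f) :
    LVCat.FullyFaithful hf.1.toLVFunctor :=
  fun xs x => le_antisymm (LVFunctor.hom_le hf.1.toLVFunctor xs x) fun h => hf.2 xs x h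

theorem isEmbedding_map {f : A.toLVCat ⟶ B.toLVCat} (hf : LVCat.FullyFaithful f) :
    A.IsEmbedding B (LVFunctor.map f : X → Y) :=
  ⟨isMorphism_map f, fun xs x h => (hf xs x).ge h⟩

variable (A) in
/-- If the implications of a quantum B-algebra are the residuals of a monoid structure with unit
`u`, then its multicategory relation is that of the ordered monoid. -/
theorem toLVCat_eq_ordMon [Monoid X] [MulLeftMono X] [MulRightMono X] (hu : (1 : X) = A.u)
    (h : ∀ x y z : X, x * y ≤ z ↔ x ≤ A.rimp y z) : A.toLVCat = (ordMon X).toLVCat := by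
  refine LVCat.ext_hom fun xs y => Two.eq_of_iff ?_
  refine (A.multiLE_iff xs y).trans (Iff.trans ?_ (ordMon_hom_iff xs y).symm)
  have key : ∀ w : X, w * xs.prod ≤ y ↔ w ≤ xs.foldr A.rimp y := by
    induction xs with
    | nil => simp
    | cons x xs ih =>
      intro w
      rw [List.prod_cons, ← mul_assoc, ih, h, List.foldr_cons]
  rw [← key, ← hu, one_mul]

theorem isUnitalQuantale_iff_isVQuantale : A.IsUnitalQuantale ↔ A.toLVCat.IsVQuantale := by
  have hmono : ∀ m : Monoid X,
      (∀ x y z : X, (x * y ≤ z ↔ x ≤ A.rimp y z) ∧ (x * y ≤ z ↔ y ≤ A.limp x z)) →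
        MulLeftMono X ∧ MulRightMono X := fun m h =>
    ⟨⟨fun x y y' hy => (h _ _ _).2.2 (hy.trans ((h x y' _).2.1 le_rfl))⟩,
      ⟨fun x y y' hy => (h _ _ _).1.2 (hy.trans ((h y' x _).1.1 le_rfl))⟩⟩
  constructor
  · rintro ⟨m, hm, hu, h⟩
    obtain ⟨hl, hr⟩ := hmono m h
    rw [A.toLVCat_eq_ordMon hu fun x y z => (h x y z).1]
    exact ⟨_, ordMon_isVQuantale_iff.2 hm, rfl⟩
  · intro hA
    obtain ⟨-, -, m, hm, -⟩ := A.toLVCat.isVQuantale_iff.1 hA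
    let m' : Monoid X := m
    have hm' : ∀ (xs : List X) (y : X), A.multiLE xs y ↔ xs.prod ≤ y := fun xs y =>
      iff_of_eq (hm xs y)
    have hu : (1 : X) = A.u := le_antisymm ((hm' [] _).1 le_rfl) ((hm' [] 1).2 le_rfl)
    have h : ∀ x y z : X, (x * y ≤ z ↔ x ≤ A.rimp y z) ∧ (x * y ≤ z ↔ y ≤ A.limp x z) := by
      intro x y z
      have h1 := hm' [x, y] z
      rw [List.prod_pair] at h1
      exact ⟨h1.symm, h1.symm.trans (A.le_rimp_iff x y z)⟩
    obtain ⟨hl, hr⟩ := hmono m' h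
    rw [A.toLVCat_eq_ordMon hu fun x y z => (h x y z).1, MonVCat.toLVCat_isVQuantale_iff,
      ordMon_isVQuantale_iff] at hA
    exact ⟨m', hA, hu, h⟩

/-- A unital quantale is a quantum B-algebra with its residuals. -/
theorem exists_toLVCat_eq_ordMon {N : Type w} [Monoid N] [PartialOrder N] [MulLeftMono N]
    [MulRightMono N] (hN : OrdMonoidIsQuantale N) :
    ∃ C : QuantumBAlgebra N, C.toLVCat = (ordMon N).toLVCat := by
  obtain ⟨hsup, hmul⟩ := hN
  choose r hr using fun y z : N => hsup {x | x * y ≤ z}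
  choose l hl using fun x z : N => hsup {y | x * y ≤ z}
  have hr' : ∀ x y z, x * y ≤ z ↔ x ≤ r y z := by
    refine fun x y z => ⟨fun h => (hr y z).1 h, fun h => (mul_le_mul_left h y).trans ?_⟩
    refine (hmul _ _ y (hr y z)).2.2 ?_
    rintro _ ⟨x, hx, rfl⟩
    exact hx
  have hl' : ∀ x y z, x * y ≤ z ↔ y ≤ l x z := by
    refine fun x y z => ⟨fun h => (hl x z).1 h, fun h => (mul_le_mul_right h x).trans ?_⟩
    refine (hmul _ _ x (hl x z)).1.2 ?_
    rintro _ ⟨y, hy, rfl⟩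
    exact hy
  refine ⟨{
    rimp := r
    limp := l
    u := 1
    rimp_mono := fun x y z h => (hr' _ _ _).1 (((hr' _ _ _).2 le_rfl).trans h)
    limp_mono := fun x y z h => (hl' _ _ _).1 (((hl' _ _ _).2 le_rfl).trans h)
    le_rimp_iff := fun x y z => (hr' x y z).symm.trans (hl' x y z)
    rimp_limp := fun x y z => eq_of_forall_le_iff fun w => by
      rw [← hr', ← hl', ← hl', ← hr', mul_assoc]
    u_rimp := fun x => eq_of_forall_le_iff fun w => by rw [← hr', mul_one]
    u_limp := fun x => eq_of_forall_le_iff fun w => by rw [← hl', one_mul] }, ?_⟩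
  exact toLVCat_eq_ordMon _ rfl hr'

theorem isInjective_iff_isUnitalQuantale : A.IsInjective ↔ A.IsUnitalQuantale := by
  rw [isUnitalQuantale_iff_isVQuantale]
  constructor
  · intro hA
    obtain ⟨Q, hQ, i, hi, hret⟩ := LVCat.Separated.exists_retract_test.{0, w} A.toLVCat_separated
    obtain ⟨N, _, _, _, _, hN⟩ := Q.exists_ordMon hQ.1
    have hN' : OrdMonoidIsQuantale N := by
      rw [← ordMon_isVQuantale_iff, ← MonVCat.toLVCat_isVQuantale_iff, hN,
        MonVCat.toLVCat_isVQuantale_iff]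
      exact hQ
    obtain ⟨C, hC⟩ := exists_toLVCat_eq_ordMon hN'
    have key : ∃ i : A.toLVCat ⟶ C.toLVCat, LVCat.FullyFaithful i ∧
        ∀ r, i ≫ r = 𝟙 _ → A.toLVCat.IsVQuantale := by
      rw [hC, hN]
      exact ⟨i, hi, hret⟩
    obtain ⟨i, hi, hret⟩ := key
    obtain ⟨r, hr, hri⟩ := hA X N A C (LVFunctor.map i) id (isEmbedding_map hi)
      (isMorphism_map (𝟙 A.toLVCat))
    exact hret hr.toLVFunctor (LVFunctor.ext hri)
  · intro hA Y Z _ _ B C i g hi hg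
    obtain ⟨h, hh⟩ := hA.exists_extension hi.1.toLVFunctor hg.toLVFunctor hi.fullyFaithful
    exact ⟨LVFunctor.map h, isMorphism_map h, congrArg LVFunctor.map hh⟩

end QuantumBAlgebra

theorem ordMonoidInjective_iff_isQuantale (M : Type w) [Monoid M] [PartialOrder M]
    [MulLeftMono M] [MulRightMono M] : OrdMonoidInjective M ↔ OrdMonoidIsQuantale M := by
  rw [← ordMon_isVQuantale_iff, ← MonVCat.toLVCat_isVQuantale_iff]
  constructor
  · intro hM
    obtain ⟨Q, hQ, hQ'⟩ :=
      LVCat.Separated.exists_retract_test.{0, w} (ordMon_toLVCat_separated (M := M))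
    obtain ⟨N, _, _, _, _, hN⟩ := Q.exists_ordMon hQ.1
    rw [← hN] at hQ'
    obtain ⟨i, hi, hret⟩ := hQ'
    obtain ⟨r, hr, hri⟩ := hM M N (LVFunctor.map i) id (isOrdMonoidEmbedding_map hi)
      (isSubmultiplicative_map (𝟙 (ordMon M).toLVCat))
    exact hret hr.toLVFunctor (LVFunctor.ext hri)
  · intro hM A B _ _ _ _ _ _ _ _ i g hi hg
    obtain ⟨h, hh⟩ := hM.exists_extension hi.1.toLVFunctor hg.toLVFunctor hi.fullyFaithful
    exact ⟨LVFunctor.map h, isSubmultiplicative_map h, congrArg LVFunctor.map hh⟩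

end Ordered

theorem mainTheorem3 :
    (∀ (V : Type v) [CommMonoid V] [CompleteLattice V] [IsQuantale V], (1 : V) ≠ ⊥ →
      -- full subcategories containing all `V`-quantales
      (∀ C : ObjectProperty (LVCat.{v, max w v} V),
        (∀ Q : MonVCat.{v, max w v} V, Q.IsVQuantale → C ((kmp V).obj Q)) →
        ∀ X : C.FullSubcategory, X.obj.Separated →
          (InjectiveAlong C.ι X ↔ X.obj.IsVQuantale)) ∧
      -- promonoidal `V`-categories
      (∀ X : VPro.{v, max w v} V, X.toVCat.Separated →
        (InjectiveAlong (proToLVCat V) X ↔ ((proToLVCat V).obj X).IsVQuantale)) ∧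
      -- monoidal `V`-categories with lax monoidal functors
      (∀ X : MonVCat.{v, max w v} V, X.toVCat.Separated →
        (InjectiveAlong (kmp V) X ↔ X.IsVQuantale)) ∧
      -- residuated monoidal `V`-categories with lax monoidal functors
      (∀ X : ResMonVCat.{v, max w v} V, X.obj.toVCat.Separated →
        (InjectiveAlong (resMonToLVCat V) X ↔ X.obj.IsVQuantale)) ∧
      -- `V`-quantum B-algebras
      (∀ X : VQBAlg.{v, max w v} V, X.toVCat.Separated →
        (InjectiveAlong (qbToLVCat V) X ↔ ((qbToLVCat V).obj X).IsVQuantale))) ∧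
    -- partially ordered monoids
    (∀ (M : Type w) [Monoid M] [PartialOrder M] [MulLeftMono M] [MulRightMono M],
      OrdMonoidInjective M ↔ OrdMonoidIsQuantale M) ∧
    -- quantum B-algebras
    (∀ (X : Type w) [PartialOrder X] (A : QuantumBAlgebra X),
      A.IsInjective ↔ A.IsUnitalQuantale) := by
  refine ⟨fun V _ _ _ _ => ⟨fun C hC X hX => ?_, fun X hX => ?_, fun X hX => ?_, fun X hX => ?_,
    fun X hX => ?_⟩, fun M _ _ _ _ => ordMonoidInjective_iff_isQuantale M,
    fun X _ A => A.isInjective_iff_isUnitalQuantale⟩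
  · exact injectiveAlong_iff_isVQuantale C.ι (fun Q hQ => ⟨⟨_, hC Q hQ⟩, rfl⟩) X hX
  · exact injectiveAlong_iff_isVQuantale (proToLVCat V)
      (fun Q _ => ⟨Q.toVPro, Q.toLVCat_toVPro⟩) X hX
  · rw [← X.toLVCat_isVQuantale_iff]
    refine injectiveAlong_iff_isVQuantale (kmp V) (fun Q _ => ⟨Q, rfl⟩) X ?_
    exact (congrArg VCat.Separated X.underlying_toLVCat).mpr hX
  · rw [← X.obj.toLVCat_isVQuantale_iff]
    have : (resMonToLVCat V).Full := inferInstanceAs (ObjectProperty.ι _ ⋙ kmp V).Full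
    have : (resMonToLVCat V).Faithful := inferInstanceAs (ObjectProperty.ι _ ⋙ kmp V).Faithful
    refine injectiveAlong_iff_isVQuantale (resMonToLVCat V)
      (fun Q hQ => ⟨⟨Q, hQ.isResiduated⟩, rfl⟩) X ?_
    exact (congrArg VCat.Separated X.obj.underlying_toLVCat).mpr hX
  · have : (qbToLVCat V).Full := inferInstanceAs (qbToPro V ⋙ proToLVCat V).Full
    have : (qbToLVCat V).Faithful := inferInstanceAs (qbToPro V ⋙ proToLVCat V).Faithful
    refine injectiveAlong_iff_isVQuantale (qbToLVCat V) (fun Q hQ => ?_) X hX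
    obtain ⟨Z, hZ⟩ := hQ.isResiduated.exists_vqbAlg
    refine ⟨Z, Eq.trans ?_ Q.toLVCat_toVPro⟩
    exact congrArg VPro.toLVCat hZ
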